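/- Let $\Gamma\subset\mathbb{R}^2$ be a compact smooth curve with non-vanishing curvature, i.e. $\Gamma=\gamma([0,1])$ for a $C^\infty$ map $\gamma:[0,1]\to\mathbb{R}^2$ with $\gamma'(t)\neq 0$ and $\det(\gamma'(t),\gamma''(t))\neq 0$ for all $t\in[0,1]$ (closed curves and self-intersections are allowed). Let $d\sigma_\Gamma$ be the arc-length measure, i.e. the one-dimensional Hausdorff measure restricted to $\Gamma$. For a function $a$ on $\mathbb{R}^2$ and Schwartz functions $f,g$ on $\mathbb{R}$ put $$T_{a\,d\sigma_\Gamma}(f,g)(x)=\int_\Gamma e^{ix(\xi+\eta)}\,\widehat f(\xi)\,\widehat g(\eta)\,a(\xi,\eta)\,d\sigma_\Gamma(\xi,\eta),\qquad \widehat f(\xi)=\frac{1}{\sqrt{2\pi}}\int_{\mathbb{R}} e^{-ix\xi}f(x)\,dx,$$ and let $T_\Gamma=T_{1\,d\sigma_\Gamma}$ be the bilinear restriction-extension operator. Let $(p,q,r)\in[1,2]^3$ be such that $(1/p,1/q,1/r)$ lies in the (closed) convex hull of the seven points $(1/p_0,1/q_0,1/r_0)$, where $(p_0,q_0,r_0)$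 runs through $$(1,1,1),\quad (1,1,2),(1,2,1),(2,1,1),\quad (3/2,3/2,1),(3/2,1,3/2),(1,3/2,3/2),$$ and suppose that $(p,q,r)$ is none of the three points $(1,1,2),(1,2,1),(2,1,1)$. Let $1/r+1/r'=1$. Then $T_\Gamma$ is bounded from $L^p(\mathbb{R})\times L^q(\mathbb{R})$ into $L^{r'}(\mathbb{R})$, i.e. it extends from Schwartz functions to a continuous bilinear map between these spaces. Moreover, for every smooth compactly supported $a:\mathbb{R}^2\to\mathbb{C}$, the operator $T_{a\,d\sigma_\Gamma}$ is bounded from $L^p(\mathbb{R})\times L^q(\mathbb{R})$ into $L^{r'}(\mathbb{R})$. -/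

import Mathlib

open MeasureTheory Set
open scoped ENNReal ContDiff SchwartzMap

noncomputable section

namespace BilinearRestriction

/-- The frequency plane; a point `z` has coordinates `ξ = z 0` and `η = z 1`. -/
abbrev Plane : Type := EuclideanSpace ℝ (Fin 2)

/-- The velocity of a curve parametrized by `[0, 1]` (one-sided at the end points). -/
def velocity (γ : ℝ → Plane) : ℝ → Plane := derivWithin γ (Icc 0 1)

/-- The acceleration of a curve parametrized by `[0, 1]` (one-sided at the end points). -/
def acceleration (γ : ℝ → Plane) : ℝ → Plane := derivWithin (velocity γ) (Icc 0 1)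

/-- The signed curvature `(x' y'' - y' x'') / |γ'|³` of a plane curve `γ = (x, y)`. -/
def signedCurvature (γ : ℝ → Plane) (t : ℝ) : ℝ :=
  (velocity γ t 0 * acceleration γ t 1 - velocity γ t 1 * acceleration γ t 0) / ‖velocity γ t‖ ^ 3

/-- `Γ` is a compact smooth curve with non-vanishing curvature: the image of `[0, 1]` under a
`C^∞` map with nowhere vanishing velocity and nowhere vanishing curvature. Closed curves are
included, and self-intersections are allowed. -/
def IsSmoothCurvedCurve (Γ : Set Plane) : Prop :=
  ∃ γ : ℝ → Plane, ContDiffOn ℝ ∞ γ (Icc 0 1) ∧ γ '' Icc 0 1 = Γ ∧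
    (∀ t ∈ Icc (0 : ℝ) 1, velocity γ t ≠ 0) ∧ ∀ t ∈ Icc (0 : ℝ) 1, signedCurvature γ t ≠ 0

/-- The arc-length measure `dσ_Γ`: one-dimensional Hausdorff measure restricted to `Γ`. -/
def arcLength (Γ : Set Plane) : Measure Plane := (Measure.hausdorffMeasure 1).restrict Γ

/-- The Fourier transform `(2π)^{-1/2} ∫ e^{-ixξ} f(x) dx`. -/
def fourierHat (f : ℝ → ℂ) (ξ : ℝ) : ℂ :=
  ((Real.sqrt (2 * Real.pi))⁻¹ : ℝ) * ∫ x : ℝ, Complex.exp (-Complex.I * x * ξ) * f x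

/-- The bilinear multiplier whose symbol is the measure `a dσ_Γ`, on Schwartz functions:
`(f, g) ↦ (x ↦ ∫ e^{ix(ξ+η)} f^(ξ) g^(η) a(ξ, η) dσ_Γ(ξ, η))`. -/
def curveMultiplier (Γ : Set Plane) (a : Plane → ℂ) (f g : 𝓢(ℝ, ℂ)) (x : ℝ) : ℂ :=
  ∫ z, Complex.exp (Complex.I * x * (z 0 + z 1)) * fourierHat f (z 0) * fourierHat g (z 1) * a z
    ∂(arcLength Γ)

/-- A bilinear operator `T`, given on Schwartz functions, is bounded from `L^p × L^q` to `L^s`: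
it agrees on Schwartz functions with a continuous bilinear map `L^p × L^q → L^s`
(a unique one if `p` and `q` are finite). -/
def IsBoundedBilinear (T : 𝓢(ℝ, ℂ) → 𝓢(ℝ, ℂ) → ℝ → ℂ) (p q s : ℝ≥0∞)
    [Fact (1 ≤ p)] [Fact (1 ≤ q)] [Fact (1 ≤ s)] : Prop :=
  ∃ B : Lp ℂ p (volume : Measure ℝ) →L[ℂ] Lp ℂ q (volume : Measure ℝ) →L[ℂ]
      Lp ℂ s (volume : Measure ℝ),
    ∀ f g : 𝓢(ℝ, ℂ), B (f.toLp p volume) (g.toLp q volume) =ᵐ[volume] T f g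

/-- `Γ` satisfies the bilinear restriction-extension inequality from `L^p × L^q` to `L^s`: for
every smooth compactly supported `a`, the multiplier with symbol `a dσ_Γ` is bounded. -/
def RestrictionExtension (Γ : Set Plane) (p q s : ℝ≥0∞)
    [Fact (1 ≤ p)] [Fact (1 ≤ q)] [Fact (1 ≤ s)] : Prop :=
  ∀ a : Plane → ℂ, ContDiff ℝ ∞ a → HasCompactSupport a →
    IsBoundedBilinear (curveMultiplier Γ a) p q s

/-- The seven exponent triples `(p, q, r)` that span the range of exponents. -/
def vertexExponents : Set (Fin 3 → ℝ) :=
  {![1, 1, 1],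
   ![1, 1, 2], ![1, 2, 1], ![2, 1, 1],
   ![3 / 2, 3 / 2, 1], ![3 / 2, 1, 3 / 2], ![1, 3 / 2, 3 / 2]}

/-- The convex hull of the seven vertices, in the coordinates `(1/p, 1/q, 1/r)`. -/
def exponentRegion : Set (Fin 3 → ℝ) :=
  convexHull ℝ ((fun v i => (v i)⁻¹) '' vertexExponents)

end BilinearRestriction

end

/-!
Pairing `T_{a dσ}(f, g)` with a third function `h` turns the claim into a bound for the trilinear
form `∫_Γ |F(ξ)| |G(η)| |H(-(ξ + η))| dσ`, where `F`, `G`, `H` are the Fourier transforms of `f`, `g`,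
`h`. Put `α = 1 - 1/p`, `β = 1 - 1/q`, `κ = 1 - 1/r`. The convex hull lies in the set where
`2α + β + κ ≤ 1`, `α + 2β + κ ≤ 1` and `α + β + 2κ ≤ 1`, and the only points of it with a coordinate
`1/2` are the three excluded vertices; so `α, β, κ < 1/2`.

On the curve `γ`, each of the functionals `ξ`, `η`, `-(ξ + η)` is a function of `t ∈ [0, 1]` whose
first two derivatives have no common zero, because the curvature does not vanish. Hence it has only
fold singularities, and two of them never degenerate at the same point because the velocity does
not vanish (`exists_lintegral_arcLength_fourier_le`). So `[0, 1]` splits into three sets on each of which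
only one functional, `u₁` say, may fold.

Along a fold `u(t) ~ t²` the Hausdorff–Young inequality loses a factor two and alone is not enough:
at the vertex `(3/2, 3/2, 1)`, Hölder's inequality fails logarithmically with just `F, G ∈ L³`. The
remedy is the weighted inequality `∫ |𝓕 f|ᵖ ψ^(p-2) ≤ C ‖f‖ₚᵖ` of Paley and Hörmander, valid for
every weight with `|{ψ ≤ s}| ≤ K s` (`lintegral_fourier_rpow_mul_le`); it is Marcinkiewicz
interpolation between the `L¹ → L^∞` bound and Plancherel's identity. A choice of `ψ` depending on
`𝓕 f` gives back the Hausdorff–Young inequality, and Hölder's inequality between the two gives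
Pitt's inequality (`exists_eLpNorm_fourier_pitt_le`). With `m = |u₁'|` it is used for `F` with the measure
`m dt` and the weight `m²`, and for `G` or `H` with the measure `dt` and the weight `m`; the powers
of `m` in the product can be balanced because `2α + β + κ ≤ 1`
(`exists_lintegral_fourier_le_of_fold`).

Finally `eLpNorm_le_of_forall_integral_mul_le` returns from the trilinear form to the operator, and
`isBoundedBilinear_of_eLpNorm_le` extends it from Schwartz functions by density.
-/

namespace BilinearRestriction

open scoped FourierTransform

/-! ### The Fourier transform on `L¹ ∩ L²` -/

theorem norm_fourier_le_integral_norm (f : ℝ → ℂ) (ξ : ℝ) : ‖𝓕 f ξ‖ ≤ ∫ x, ‖f x‖ := by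
  rw [Real.fourier_real_eq]
  refine (norm_integral_le_integral_norm _).trans (le_of_eq ?_)
  simp

theorem continuous_fourier_of_integrable {f : ℝ → ℂ} (hf : Integrable f) : Continuous (𝓕 f) :=
  VectorFourier.fourierIntegral_continuous Real.continuous_fourierChar
    (by exact continuous_inner) hf

/-- Plancherel's identity for the Fourier integral of a function in `L¹ ∩ L²`. The Fourier integral
and the `L²` Fourier transform of `f` agree almost everywhere because they define the same tempered
distribution. -/
theorem eLpNorm_two_fourier_eq {f : ℝ → ℂ} (hf : Integrable f) (hf2 : MemLp f 2) :
    eLpNorm (𝓕 f) 2 = eLpNorm f 2 := by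
  have key : ∀ᵐ x, (𝓕 (hf2.toLp f) : Lp ℂ 2 (volume : Measure ℝ)) x = 𝓕 f x := by
    refine ae_eq_of_integral_contDiff_smul_eq
      ((Lp.memLp (𝓕 (hf2.toLp f))).locallyIntegrable (by norm_num))
      (continuous_fourier_of_integrable hf).locallyIntegrable fun g hg hgc ↦ ?_
    have hg₁ : HasCompactSupport (Complex.ofRealCLM ∘ g) := hgc.comp_left rfl
    have hg₂ : ContDiff ℝ ∞ (Complex.ofRealCLM ∘ g) := by fun_prop
    set φ : 𝓢(ℝ, ℂ) := hg₁.toSchwartzMap hg₂ with hφ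
    have hφg : ∀ x, φ x = (g x : ℂ) := fun x ↦ rfl
    have h := congrArg (fun T ↦ T φ) (Lp.fourier_toTemperedDistribution_eq (hf2.toLp f))
    simp only [TemperedDistribution.fourier_apply, Lp.toTemperedDistribution_apply] at h
    calc ∫ x, g x • (𝓕 (hf2.toLp f) : Lp ℂ 2 (volume : Measure ℝ)) x
        = ∫ x, φ x • (𝓕 (hf2.toLp f) : Lp ℂ 2 (volume : Measure ℝ)) x := by simp [hφg]
      _ = ∫ x, (𝓕 φ) x • (hf2.toLp f) x := h.symm
      _ = ∫ x, 𝓕 (φ : ℝ → ℂ) x • f x := by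
          refine integral_congr_ae ?_
          filter_upwards [hf2.coeFn_toLp] with x hx
          rw [hx, SchwartzMap.fourier_coe]
      _ = ∫ x, φ x • 𝓕 f x := by
          simpa using! (VectorFourier.integral_fourierIntegral_smul_eq_flip (L := innerₗ ℝ)
            Real.continuous_fourierChar continuous_inner φ.integrable hf)
      _ = _ := by simp [hφg]
  rw [← eLpNorm_congr_ae key]
  have h := Lp.norm_fourier_eq (hf2.toLp f)
  rw [Lp.norm_def, Lp.norm_def, ENNReal.toReal_eq_toReal_iff' (Lp.eLpNorm_ne_top _)
    (Lp.eLpNorm_ne_top _)] at h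
  rw [h, eLpNorm_congr_ae hf2.coeFn_toLp]

theorem lintegral_fourier_sq_eq {f : ℝ → ℂ} (hf : Integrable f) (hf2 : MemLp f 2) :
    ∫⁻ x, ‖𝓕 f x‖ₑ ^ 2 = ∫⁻ x, ‖f x‖ₑ ^ 2 := by
  have h := eLpNorm_two_fourier_eq hf hf2
  rw [eLpNorm_eq_lintegral_rpow_enorm_toReal (by simp) (by simp),
    eLpNorm_eq_lintegral_rpow_enorm_toReal (by simp) (by simp)] at h
  simpa using ENNReal.rpow_left_injective (by norm_num) h

/-! ### The Hörmander–Paley inequality -/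

theorem lintegral_Ioo_rpow_sub_two {p a : ℝ} (hp : 1 < p) (ha : 0 ≤ a) :
    ∫⁻ t in Ioo 0 a, ENNReal.ofReal (t ^ (p - 2)) = ENNReal.ofReal (a ^ (p - 1) / (p - 1)) := by
  have hint : IntervalIntegrable (fun t : ℝ ↦ t ^ (p - 2)) volume 0 a :=
    intervalIntegral.intervalIntegrable_rpow' (by linarith)
  rw [restrict_Ioo_eq_restrict_Ioc, ← ofReal_integral_eq_lintegral_ofReal]
  · rw [← intervalIntegral.integral_of_le ha, integral_rpow (Or.inl (by linarith))]
    rw [Real.zero_rpow (by linarith), show p - 2 + 1 = p - 1 by ring, sub_zero]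
  · exact (intervalIntegrable_iff_integrableOn_Ioc_of_le ha).1 hint
  · filter_upwards [ae_restrict_mem measurableSet_Ioc] with t ht
    exact Real.rpow_nonneg ht.1.le _

theorem lintegral_Ioi_rpow_sub_three {p a : ℝ} (hp : p < 2) (ha : 0 < a) :
    ∫⁻ t in Ioi a, ENNReal.ofReal (t ^ (p - 3)) = ENNReal.ofReal (a ^ (p - 2) / (2 - p)) := by
  rw [← ofReal_integral_eq_lintegral_ofReal]
  · rw [integral_Ioi_rpow_of_lt (by linarith) ha, show p - 3 + 1 = p - 2 by ring, ← neg_sub 2 p,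
      neg_div_neg_eq]
  · exact integrableOn_Ioi_rpow_of_lt (by linarith) ha
  · filter_upwards [ae_restrict_mem measurableSet_Ioi] with t ht
    exact Real.rpow_nonneg (ha.le.trans (mem_Ioi.1 ht).le) _

section Paley

variable {X : Type*} [MeasurableSpace X] {μ : Measure X} {u ψ : X → ℝ} {K C : ℝ≥0∞}

/-- If `μ {ψ ≤ s} ≤ K s`, then the measure `ψ⁻² μ` of `{ψ > r}` is at most `2 K / r`. -/
theorem withDensity_superlevel_le (hψ : Measurable ψ)
    (hK : ∀ s : ℝ, 0 < s → μ {x | ψ x ≤ s} ≤ K * ENNReal.ofReal s) {r : ℝ} (hr : 0 < r) :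
    μ.withDensity (fun x ↦ ENNReal.ofReal (ψ x ^ (-2 : ℝ))) {x | r < ψ x}
      ≤ 2 * K * ENNReal.ofReal r⁻¹ := by
  have hms : MeasurableSet {x | r < ψ x} := measurableSet_lt measurable_const hψ
  set g : X → ℝ := {x | r < ψ x}.indicator (fun x ↦ (ψ x)⁻¹) with hg
  have hg0 : ∀ x, 0 ≤ g x := fun x ↦ indicator_nonneg
    (fun x hx ↦ inv_nonneg.2 (hr.le.trans (le_of_lt hx))) x
  have hgm : Measurable g := hψ.inv.indicator hms
  have h1 : μ.withDensity (fun x ↦ ENNReal.ofReal (ψ x ^ (-2 : ℝ))) {x | r < ψ x}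
      = ∫⁻ x, ENNReal.ofReal (g x ^ (2 : ℝ)) ∂μ := by
    rw [withDensity_apply _ hms, ← lintegral_indicator hms]
    refine lintegral_congr fun x ↦ ?_
    by_cases hx : r < ψ x
    · have hx0 : 0 ≤ ψ x := hr.le.trans hx.le
      have hx' : x ∈ {x | r < ψ x} := hx
      rw [indicator_of_mem hx', hg, indicator_of_mem hx', Real.rpow_neg hx0, Real.inv_rpow hx0]
    · have hx' : x ∉ {x | r < ψ x} := hx
      rw [indicator_of_notMem hx', hg, indicator_of_notMem hx']
      simp
  rw [h1, lintegral_rpow_eq_lintegral_meas_lt_mul μ (Filter.Eventually.of_forall hg0)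
    hgm.aemeasurable two_pos]
  have h2 : ∀ t ∈ Ioi (0 : ℝ), μ {a | t < g a} * ENNReal.ofReal (t ^ ((2 : ℝ) - 1))
      ≤ (Ioo 0 r⁻¹).indicator (fun _ ↦ K) t := by
    intro t ht
    have ht0 : 0 < t := ht
    have hsub : {a | t < g a} ⊆ {a | ψ a ≤ t⁻¹ ∧ r < t⁻¹} := by
      intro x hx
      have hx1 : t < g x := hx
      by_cases hxr : r < ψ x
      · have hx' : x ∈ {x | r < ψ x} := hxr
        rw [hg, indicator_of_mem hx'] at hx1
        have hp : ψ x < t⁻¹ := by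
          rw [lt_inv_comm₀ ht0 (hr.trans hxr)] at hx1
          exact hx1
        exact ⟨hp.le, hxr.trans hp⟩
      · have hx' : x ∉ {x | r < ψ x} := hxr
        rw [hg, indicator_of_notMem hx'] at hx1
        exact absurd hx1 (not_lt.2 ht0.le)
    by_cases htr : r < t⁻¹
    · have hmem : t ∈ Ioo 0 r⁻¹ := ⟨ht0, (lt_inv_comm₀ hr ht0).1 htr⟩
      rw [indicator_of_mem hmem]
      calc μ {a | t < g a} * ENNReal.ofReal (t ^ ((2 : ℝ) - 1))
          ≤ (K * ENNReal.ofReal t⁻¹) * ENNReal.ofReal (t ^ ((2 : ℝ) - 1)) := by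
            gcongr
            exact (measure_mono (hsub.trans fun x hx ↦ hx.1)).trans (hK _ (inv_pos.2 ht0))
        _ = K := by
            rw [mul_assoc, ← ENNReal.ofReal_mul (inv_nonneg.2 ht0.le)]
            norm_num [ht0.ne']
    · have : {a | t < g a} = ∅ := by
        ext x
        simp only [mem_ofPred_eq, mem_empty_iff_false, iff_false]
        exact fun hx ↦ htr (hsub hx).2
      simp [this]
  calc ENNReal.ofReal 2 * ∫⁻ t in Ioi 0, μ {a | t < g a} * ENNReal.ofReal (t ^ ((2 : ℝ) - 1))
      ≤ ENNReal.ofReal 2 * ∫⁻ t in Ioi 0, (Ioo 0 r⁻¹).indicator (fun _ ↦ K) t := by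
        exact mul_le_mul_right (setLIntegral_mono' measurableSet_Ioi h2) _
    _ ≤ ENNReal.ofReal 2 * ∫⁻ t, (Ioo 0 r⁻¹).indicator (fun _ ↦ K) t := by
        gcongr
        exact Measure.restrict_le_self
    _ = 2 * K * ENNReal.ofReal r⁻¹ := by
        rw [lintegral_indicator measurableSet_Ioo]
        simp [mul_assoc]

/-- The distributional estimate behind the Hörmander–Paley inequality: `f` is cut at height `l`,
the large part is handled by the `L¹ → L^∞` bound and the small part by Plancherel's identity. -/
theorem withDensity_fourier_superlevel_le (hu : Measurable u) (hψ : Measurable ψ)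
    (hψ0 : ∀ x, 0 ≤ ψ x) (hK : ∀ s : ℝ, 0 < s → μ {x | ψ x ≤ s} ≤ K * ENNReal.ofReal s)
    (hC : μ.map u ≤ C • volume) {f : ℝ → ℂ} (hfm : Measurable f) (hf : Integrable f)
    (hf2 : MemLp f 2) {l : ℝ} (hl : 0 < l) :
    μ.withDensity (fun x ↦ ENNReal.ofReal (ψ x ^ (-2 : ℝ))) {x | l < ψ x * ‖𝓕 f (u x)‖}
      ≤ 4 * K * ENNReal.ofReal l⁻¹ * (∫⁻ y in {y | l < ‖f y‖}, ‖f y‖ₑ)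
        + 4 * C * ENNReal.ofReal (l ^ (-2 : ℝ)) * ∫⁻ y in {y | l < ‖f y‖}ᶜ, ‖f y‖ₑ ^ 2 := by
  set S : Set ℝ := {y | l < ‖f y‖} with hS
  have hSm : MeasurableSet S := measurableSet_lt measurable_const hfm.norm
  set ν := μ.withDensity (fun x ↦ ENNReal.ofReal (ψ x ^ (-2 : ℝ))) with hν
  set f₁ := S.indicator f with hf₁
  set f₂ := Sᶜ.indicator f with hf₂
  have hf₁i : Integrable f₁ := hf.indicator hSm
  have hf₂i : Integrable f₂ := hf.indicator hSm.compl
  have hf₂2 : MemLp f₂ 2 := hf2.indicator hSm.compl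
  have hsplit : ∀ ξ, 𝓕 f ξ = 𝓕 f₁ ξ + 𝓕 f₂ ξ := by
    intro ξ
    have : f = f₁ + f₂ := (indicator_self_add_compl S f).symm
    conv_lhs => rw [this]
    simp only [Real.fourier_real_eq, Pi.add_apply, smul_add]
    exact integral_add
      (by simpa [mul_comm] using (Real.fourierIntegral_convergent_iff (w := ξ)).2 hf₁i)
      (by simpa [mul_comm] using (Real.fourierIntegral_convergent_iff (w := ξ)).2 hf₂i)
  have hsub : {x | l < ψ x * ‖𝓕 f (u x)‖} ⊆
      {x | l / 2 < ψ x * ‖𝓕 f₁ (u x)‖} ∪ {x | l / 2 ≤ ψ x * ‖𝓕 f₂ (u x)‖} := by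
    intro x hx
    have hx : l < ψ x * ‖𝓕 f (u x)‖ := hx
    by_contra hcon
    simp only [mem_union, mem_ofPred_eq, not_or, not_lt, not_le] at hcon
    have : ψ x * ‖𝓕 f (u x)‖ ≤ ψ x * ‖𝓕 f₁ (u x)‖ + ψ x * ‖𝓕 f₂ (u x)‖ := by
      rw [← mul_add, hsplit]
      exact mul_le_mul_of_nonneg_left (norm_add_le _ _) (hψ0 x)
    linarith [hcon.1, hcon.2]
  refine (measure_mono hsub).trans ((measure_union_le _ _).trans (add_le_add ?_ ?_))
  · set N : ℝ := ∫ y, ‖f₁ y‖ with hN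
    have hNe : ENNReal.ofReal N = ∫⁻ y in S, ‖f y‖ₑ := by
      rw [hN, ofReal_integral_norm_eq_lintegral_enorm hf₁i, ← lintegral_indicator hSm]
      refine lintegral_congr fun y ↦ ?_
      rw [hf₁, enorm_indicator_eq_indicator_enorm]
    have hN0 : 0 ≤ N := integral_nonneg fun _ ↦ norm_nonneg _
    rcases hN0.eq_or_lt with hN0 | hN0
    · have : {x | l / 2 < ψ x * ‖𝓕 f₁ (u x)‖} = ∅ := by
        ext x
        simp only [mem_ofPred_eq, mem_empty_iff_false, iff_false, not_lt]
        have := norm_fourier_le_integral_norm f₁ (u x)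
        have h0 : ‖𝓕 f₁ (u x)‖ = 0 := le_antisymm (this.trans hN0.symm.le) (norm_nonneg _)
        rw [h0, mul_zero]; positivity
      rw [this]; simp
    · have hsub2 : {x | l / 2 < ψ x * ‖𝓕 f₁ (u x)‖} ⊆ {x | l / (2 * N) < ψ x} := by
        intro x hx
        have hx : l / 2 < ψ x * ‖𝓕 f₁ (u x)‖ := hx
        have h3 := mul_le_mul_of_nonneg_left (norm_fourier_le_integral_norm f₁ (u x)) (hψ0 x)
        rw [mem_ofPred_eq, div_lt_iff₀ (by positivity)]
        have h4 : l / 2 < ψ x * N := hx.trans_le h3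
        linarith
      refine (measure_mono hsub2).trans
        ((withDensity_superlevel_le hψ hK (by positivity)).trans (le_of_eq ?_))
      rw [← hNe, inv_div, show 2 * N / l = 2 * (l⁻¹ * N) by field_simp,
        ENNReal.ofReal_mul two_pos.le, ENNReal.ofReal_mul (inv_nonneg.2 hl.le), ENNReal.ofReal_ofNat]
      ring
  · have hcont : Continuous (𝓕 f₂) := continuous_fourier_of_integrable hf₂i
    have hFm : Measurable fun x ↦ ‖𝓕 f₂ (u x)‖ₑ ^ 2 :=
      (hcont.measurable.comp hu).enorm.pow_const 2
    have h1 : ∫⁻ x, ‖𝓕 f₂ (u x)‖ₑ ^ 2 ∂μ ≤ C * ∫⁻ y in Sᶜ, ‖f y‖ₑ ^ 2 := by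
      calc ∫⁻ x, ‖𝓕 f₂ (u x)‖ₑ ^ 2 ∂μ = ∫⁻ y, ‖𝓕 f₂ y‖ₑ ^ 2 ∂(μ.map u) := by
            rw [lintegral_map (hcont.measurable.enorm.pow_const 2) hu]
        _ ≤ ∫⁻ y, ‖𝓕 f₂ y‖ₑ ^ 2 ∂(C • volume) := lintegral_mono' hC le_rfl
        _ = C * ∫⁻ y, ‖f₂ y‖ₑ ^ 2 := by
            rw [lintegral_smul_measure, smul_eq_mul, lintegral_fourier_sq_eq hf₂i hf₂2]
        _ = C * ∫⁻ y in Sᶜ, ‖f y‖ₑ ^ 2 := by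
            rw [← lintegral_indicator hSm.compl]
            congr 1
            refine lintegral_congr fun y ↦ ?_
            by_cases hy : y ∈ Sᶜ
            · simp only [hf₂, indicator_of_mem hy]
            · simp only [hf₂, indicator_of_notMem hy]; simp
    have hpos : ENNReal.ofReal (l / 2) ^ 2 ≠ 0 := by simp [hl]
    have htop : ENNReal.ofReal (l / 2) ^ 2 ≠ ⊤ := by simp
    have h2 : ENNReal.ofReal (l / 2) ^ 2 * ν {x | l / 2 ≤ ψ x * ‖𝓕 f₂ (u x)‖}
        ≤ ∫⁻ x, ‖𝓕 f₂ (u x)‖ₑ ^ 2 ∂μ := by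
      have hm : Measurable fun x ↦ ENNReal.ofReal (ψ x * ‖𝓕 f₂ (u x)‖) ^ 2 :=
        ((hψ.mul (hcont.measurable.comp hu).norm).ennreal_ofReal).pow_const 2
      calc ENNReal.ofReal (l / 2) ^ 2 * ν {x | l / 2 ≤ ψ x * ‖𝓕 f₂ (u x)‖}
          ≤ ENNReal.ofReal (l / 2) ^ 2 *
              ν {x | ENNReal.ofReal (l / 2) ^ 2 ≤ ENNReal.ofReal (ψ x * ‖𝓕 f₂ (u x)‖) ^ 2} := by
            gcongr with x
            intro hx
            gcongr
        _ ≤ ∫⁻ x, ENNReal.ofReal (ψ x * ‖𝓕 f₂ (u x)‖) ^ 2 ∂ν := mul_meas_ge_le_lintegral hm _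
        _ = ∫⁻ x, ENNReal.ofReal (ψ x ^ (-2 : ℝ)) * ENNReal.ofReal (ψ x * ‖𝓕 f₂ (u x)‖) ^ 2 ∂μ := by
            rw [hν, lintegral_withDensity_eq_lintegral_mul _ (by fun_prop) hm]
            rfl
        _ ≤ ∫⁻ x, ‖𝓕 f₂ (u x)‖ₑ ^ 2 ∂μ := by
            refine lintegral_mono fun x ↦ ?_
            rw [ENNReal.ofReal_mul (hψ0 x), mul_pow, ← mul_assoc, ofReal_norm]
            refine mul_le_of_le_one_left zero_le ?_
            rw [← ENNReal.ofReal_pow (hψ0 x), ← ENNReal.ofReal_mul (by positivity [hψ0 x])]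
            rw [ENNReal.ofReal_le_one, Real.rpow_neg (hψ0 x)]
            norm_cast
            exact inv_mul_le_one
    have h3 := h2.trans h1
    rw [mul_comm, ← ENNReal.le_div_iff_mul_le (Or.inl hpos) (Or.inl htop)] at h3
    refine h3.trans (le_of_eq ?_)
    rw [ENNReal.div_eq_inv_mul, ← mul_assoc]
    congr 1
    rw [← ENNReal.ofReal_pow (by positivity), ← ENNReal.ofReal_inv_of_pos (by positivity),
      show ((l / 2) ^ 2)⁻¹ = 4 * l ^ (-2 : ℝ) by
        rw [Real.rpow_neg hl.le]; norm_cast; field_simp; norm_num,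
      ENNReal.ofReal_mul (by norm_num), ENNReal.ofReal_ofNat]
    ring

theorem lintegral_superlevel_rpow {p a : ℝ} (hp : 1 < p) (ha : 0 ≤ a) :
    ∫⁻ t in Ioi (0 : ℝ), ENNReal.ofReal (t ^ (p - 2)) * (if t < a then ENNReal.ofReal a else 0)
      = ENNReal.ofReal (p - 1)⁻¹ * ENNReal.ofReal (a ^ p) := by
  have h1 : ∀ t ∈ Ioi (0 : ℝ), ENNReal.ofReal (t ^ (p - 2)) * (if t < a then ENNReal.ofReal a else 0)
      = (Iio a).indicator (fun t ↦ ENNReal.ofReal (t ^ (p - 2)) * ENNReal.ofReal a) t := by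
    intro t _
    by_cases h : t < a
    · rw [if_pos h, indicator_of_mem (mem_Iio.2 h)]
    · rw [if_neg h, indicator_of_notMem (by simpa using h), mul_zero]
  rw [setLIntegral_congr_fun measurableSet_Ioi h1, setLIntegral_indicator measurableSet_Iio,
    Iio_inter_Ioi, lintegral_mul_const' _ _ ENNReal.ofReal_ne_top, lintegral_Ioo_rpow_sub_two hp ha,
    ← ENNReal.ofReal_mul (by have := Real.rpow_nonneg ha (p - 1); bound),
    ← ENNReal.ofReal_mul (by bound)]
  congr 1
  rcases ha.eq_or_lt with rfl | ha
  · rw [Real.zero_rpow (by linarith : p ≠ 0)]; simp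
  · rw [Real.rpow_sub_one ha.ne']; field_simp

theorem lintegral_sublevel_rpow {p a : ℝ} (hp0 : 0 < p) (hp : p < 2) (ha : 0 ≤ a) :
    ∫⁻ t in Ioi (0 : ℝ),
        ENNReal.ofReal (t ^ (p - 3)) * (if t < a then 0 else ENNReal.ofReal a ^ 2)
      = ENNReal.ofReal (2 - p)⁻¹ * ENNReal.ofReal (a ^ p) := by
  rcases ha.eq_or_lt with rfl | ha
  · rw [Real.zero_rpow hp0.ne']; simp
  have h1 : ∀ t ∈ Ioi (0 : ℝ),
      ENNReal.ofReal (t ^ (p - 3)) * (if t < a then 0 else ENNReal.ofReal a ^ 2)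
      = (Ici a).indicator (fun t ↦ ENNReal.ofReal (t ^ (p - 3)) * ENNReal.ofReal a ^ 2) t := by
    intro t _
    by_cases h : t < a
    · rw [if_pos h, indicator_of_notMem (by simpa using h), mul_zero]
    · rw [if_neg h, indicator_of_mem (by simpa using h)]
  rw [setLIntegral_congr_fun measurableSet_Ioi h1, setLIntegral_indicator measurableSet_Ici,
    inter_eq_left.2 (Ici_subset_Ioi.2 ha),
    lintegral_mul_const' _ _ (by simp), setLIntegral_congr Ioi_ae_eq_Ici.symm,
    lintegral_Ioi_rpow_sub_three hp ha, ← ENNReal.ofReal_pow ha.le,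
    ← ENNReal.ofReal_mul (by have := Real.rpow_nonneg ha.le (p - 2); bound),
    ← ENNReal.ofReal_mul (by bound)]
  congr 1
  rw [Real.rpow_sub ha]
  norm_cast
  field_simp

/-- The Hörmander–Paley inequality
`∫ |𝓕 f (u)|ᵖ ψ^(p - 2) dμ ≤ C ∫ |f|ᵖ` for `1 < p < 2`, when the image of `μ` under `u` is
dominated by Lebesgue measure and `μ {ψ ≤ s} ≤ K s`. It is the Marcinkiewicz interpolation theorem
for `f ↦ ψ · (𝓕 f ∘ u)` and the measure `ψ⁻² μ`. -/
theorem lintegral_fourier_rpow_mul_le (hu : Measurable u) (hψ : Measurable ψ)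
    (hψ0 : ∀ x, 0 ≤ ψ x) (hK : ∀ s : ℝ, 0 < s → μ {x | ψ x ≤ s} ≤ K * ENNReal.ofReal s)
    (hC : μ.map u ≤ C • volume) {p : ℝ} (hp : 1 < p) (hp2 : p < 2)
    {f : ℝ → ℂ} (hfm : Measurable f) (hf : Integrable f) (hf2 : MemLp f 2) :
    ∫⁻ x, ENNReal.ofReal (‖𝓕 f (u x)‖ ^ p * ψ x ^ (p - 2)) ∂μ
      ≤ ENNReal.ofReal p * (4 * K * ENNReal.ofReal (p - 1)⁻¹ + 4 * C * ENNReal.ofReal (2 - p)⁻¹)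
        * ∫⁻ y, ENNReal.ofReal (‖f y‖ ^ p) := by
  have hcont : Continuous (𝓕 f) := continuous_fourier_of_integrable hf
  set ν := μ.withDensity (fun x ↦ ENNReal.ofReal (ψ x ^ (-2 : ℝ))) with hν
  have hFm : Measurable fun x ↦ ‖𝓕 f (u x)‖ := (hcont.measurable.comp hu).norm
  have hzm : Measurable fun x ↦ ψ x * ‖𝓕 f (u x)‖ := hψ.mul hFm
  have h1 : ∫⁻ x, ENNReal.ofReal (‖𝓕 f (u x)‖ ^ p * ψ x ^ (p - 2)) ∂μ
      = ∫⁻ x, ENNReal.ofReal ((ψ x * ‖𝓕 f (u x)‖) ^ p) ∂ν := by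
    rw [hν, lintegral_withDensity_eq_lintegral_mul _ (by fun_prop)
      (hzm.pow_const p).ennreal_ofReal]
    refine lintegral_congr fun x ↦ ?_
    simp only [Pi.mul_apply]
    rw [← ENNReal.ofReal_mul (Real.rpow_nonneg (hψ0 x) _)]
    congr 1
    rw [Real.mul_rpow (hψ0 x) (norm_nonneg _)]
    rcases (hψ0 x).eq_or_lt with h | h
    · rw [← h, Real.zero_rpow (by linarith : p - 2 ≠ 0), Real.zero_rpow (by norm_num)]; simp
    · rw [sub_eq_add_neg, Real.rpow_add h]; ring
  rw [h1, lintegral_rpow_eq_lintegral_meas_lt_mul ν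
    (Filter.Eventually.of_forall fun x ↦ mul_nonneg (hψ0 x) (norm_nonneg _)) hzm.aemeasurable
    (by linarith), mul_assoc]
  refine mul_le_mul_right ?_ _
  set G₁ : ℝ → ℝ → ℝ≥0∞ := fun t y ↦
    ENNReal.ofReal (t ^ (p - 2)) * (if t < ‖f y‖ then ENNReal.ofReal ‖f y‖ else 0) with hG₁
  set G₂ : ℝ → ℝ → ℝ≥0∞ := fun t y ↦
    ENNReal.ofReal (t ^ (p - 3)) * (if t < ‖f y‖ then 0 else ENNReal.ofReal ‖f y‖ ^ 2) with hG₂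
  have hms : MeasurableSet {z : ℝ × ℝ | z.1 < ‖f z.2‖} :=
    measurableSet_lt measurable_fst (hfm.comp measurable_snd).norm
  have hn : Measurable fun z : ℝ × ℝ ↦ ENNReal.ofReal ‖f z.2‖ :=
    (hfm.comp measurable_snd).norm.ennreal_ofReal
  have hG₁m : Measurable (Function.uncurry G₁) :=
    (by fun_prop : Measurable fun z : ℝ × ℝ ↦ ENNReal.ofReal (z.1 ^ (p - 2))).mul
      (Measurable.ite hms hn measurable_const)
  have hG₂m : Measurable (Function.uncurry G₂) :=
    (by fun_prop : Measurable fun z : ℝ × ℝ ↦ ENNReal.ofReal (z.1 ^ (p - 3))).mul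
      (Measurable.ite hms measurable_const (hn.pow_const 2))
  have hbound : ∀ t ∈ Ioi (0 : ℝ),
      ν {x | t < ψ x * ‖𝓕 f (u x)‖} * ENNReal.ofReal (t ^ (p - 1))
        ≤ 4 * K * (∫⁻ y, G₁ t y) + 4 * C * ∫⁻ y, G₂ t y := by
    intro t ht
    have ht0 : 0 < t := ht
    have hSm : MeasurableSet {y | t < ‖f y‖} := measurableSet_lt measurable_const hfm.norm
    have e1 : ∫⁻ y, G₁ t y = ENNReal.ofReal (t ^ (p - 2)) * ∫⁻ y in {y | t < ‖f y‖}, ‖f y‖ₑ := by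
      rw [← lintegral_indicator hSm, ← lintegral_const_mul' _ _ ENNReal.ofReal_ne_top]
      refine lintegral_congr fun y ↦ ?_
      simp [hG₁, indicator_apply]
    have e2 : ∫⁻ y, G₂ t y
        = ENNReal.ofReal (t ^ (p - 3)) * ∫⁻ y in {y | t < ‖f y‖}ᶜ, ‖f y‖ₑ ^ 2 := by
      rw [← lintegral_indicator hSm.compl, ← lintegral_const_mul' _ _ ENNReal.ofReal_ne_top]
      refine lintegral_congr fun y ↦ ?_
      by_cases h : t < ‖f y‖ <;> simp [hG₂, h]
    refine (mul_le_mul_left (withDensity_fourier_superlevel_le hu hψ hψ0 hK hC hfm hf hf2 ht0)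
      _).trans (le_of_eq ?_)
    have r1 : ENNReal.ofReal (t ^ (p - 2)) = ENNReal.ofReal t⁻¹ * ENNReal.ofReal (t ^ (p - 1)) := by
      rw [← ENNReal.ofReal_mul (by positivity), ← Real.rpow_neg_one, ← Real.rpow_add ht0]
      ring_nf
    have r2 : ENNReal.ofReal (t ^ (p - 3))
        = ENNReal.ofReal (t ^ (-2 : ℝ)) * ENNReal.ofReal (t ^ (p - 1)) := by
      rw [← ENNReal.ofReal_mul (by positivity), ← Real.rpow_add ht0]
      ring_nf
    rw [e1, e2, r1, r2]
    ring
  refine (setLIntegral_mono' measurableSet_Ioi hbound).trans (le_of_eq ?_)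
  have hI₁ : Measurable fun t ↦ ∫⁻ y, G₁ t y := hG₁m.lintegral_prod_right'
  have hI₂ : Measurable fun t ↦ ∫⁻ y, G₂ t y := hG₂m.lintegral_prod_right'
  rw [lintegral_add_left (hI₁.const_mul _), lintegral_const_mul _ hI₁, lintegral_const_mul _ hI₂,
    lintegral_lintegral_swap hG₁m.aemeasurable, lintegral_lintegral_swap hG₂m.aemeasurable]
  simp only [hG₁, hG₂, lintegral_superlevel_rpow hp (norm_nonneg _),
    lintegral_sublevel_rpow (zero_lt_one.trans hp) hp2 (norm_nonneg _)]
  rw [lintegral_const_mul' _ _ ENNReal.ofReal_ne_top, lintegral_const_mul' _ _ ENNReal.ofReal_ne_top]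
  ring

end Paley

/-! ### Hausdorff–Young and Pitt inequalities -/

section Pitt

variable {X : Type*} [MeasurableSpace X] {μ : Measure X} {u ψ : X → ℝ} {K C : ℝ≥0∞}

/-- The norm of `L^{1/σ}` as a power of an integral. -/
theorem eLpNorm_inv_ofReal {E : Type*} [NormedAddCommGroup E] {g : X → E} {σ : ℝ} (hσ : 0 < σ) :
    eLpNorm g (ENNReal.ofReal σ)⁻¹ μ = (∫⁻ x, ENNReal.ofReal (‖g x‖ ^ σ⁻¹) ∂μ) ^ σ := by
  have h : ((ENNReal.ofReal σ)⁻¹).toReal = σ⁻¹ := by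
    rw [ENNReal.toReal_inv, ENNReal.toReal_ofReal hσ.le]
  rw [eLpNorm_eq_lintegral_rpow_enorm_toReal (by simp) (by simpa using hσ), h, one_div, inv_inv]
  congr 1
  refine lintegral_congr fun x ↦ ?_
  rw [← ofReal_norm, ENNReal.ofReal_rpow_of_nonneg (norm_nonneg _) (inv_nonneg.2 hσ.le)]

/-- Log-convexity of the norms of `L^{1/σ}` under geometric means of functions. -/
theorem eLpNorm_rpow_mul_rpow_le {g h : X → ℝ} (hg : Measurable g) (hh : Measurable h)
    (hg0 : ∀ x, 0 ≤ g x) (hh0 : ∀ x, 0 ≤ h x) {a b θ : ℝ} (ha : 0 < a) (hb : 0 < b)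
    (hθ0 : 0 ≤ θ) (hθ1 : θ ≤ 1) :
    eLpNorm (fun x ↦ g x ^ (1 - θ) * h x ^ θ) (ENNReal.ofReal ((1 - θ) * a + θ * b))⁻¹ μ
      ≤ eLpNorm g (ENNReal.ofReal a)⁻¹ μ ^ (1 - θ) * eLpNorm h (ENNReal.ofReal b)⁻¹ μ ^ θ := by
  have hσ : 0 < (1 - θ) * a + θ * b := by
    rcases hθ0.eq_or_lt with rfl | h0
    · simpa using ha
    · have : 0 ≤ (1 - θ) * a := mul_nonneg (by linarith) ha.le
      positivity
  set σ := (1 - θ) * a + θ * b with hσd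
  rw [eLpNorm_inv_ofReal hσ, eLpNorm_inv_ofReal ha, eLpNorm_inv_ofReal hb]
  have hθ' : 0 ≤ 1 - θ := by linarith
  have key := ENNReal.lintegral_mul_norm_pow_le (μ := μ)
    (f := fun x ↦ ENNReal.ofReal (‖g x‖ ^ a⁻¹)) (g := fun x ↦ ENNReal.ofReal (‖h x‖ ^ b⁻¹))
    (by fun_prop) (by fun_prop) (p := (1 - θ) * a / σ) (q := θ * b / σ)
    (by positivity) (by positivity) (by rw [← add_div, ← hσd, div_self hσ.ne'])
  calc (∫⁻ x, ENNReal.ofReal (‖g x ^ (1 - θ) * h x ^ θ‖ ^ σ⁻¹) ∂μ) ^ σ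
      = (∫⁻ x, ENNReal.ofReal (‖g x‖ ^ a⁻¹) ^ ((1 - θ) * a / σ) *
          ENNReal.ofReal (‖h x‖ ^ b⁻¹) ^ (θ * b / σ) ∂μ) ^ σ := by
        congr 1
        refine lintegral_congr fun x ↦ ?_
        rw [ENNReal.ofReal_rpow_of_nonneg (by positivity) (by positivity),
          ENNReal.ofReal_rpow_of_nonneg (by positivity) (by positivity),
          ← ENNReal.ofReal_mul (by positivity), ← Real.rpow_mul (norm_nonneg _),
          ← Real.rpow_mul (norm_nonneg _), Real.norm_of_nonneg (hg0 x), Real.norm_of_nonneg (hh0 x),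
          Real.norm_of_nonneg (mul_nonneg (Real.rpow_nonneg (hg0 x) _)
            (Real.rpow_nonneg (hh0 x) _)),
          Real.mul_rpow (Real.rpow_nonneg (hg0 x) _) (Real.rpow_nonneg (hh0 x) _),
          ← Real.rpow_mul (hg0 x), ← Real.rpow_mul (hh0 x)]
        congr 3 <;> field_simp
    _ ≤ ((∫⁻ x, ENNReal.ofReal (‖g x‖ ^ a⁻¹) ∂μ) ^ ((1 - θ) * a / σ) *
          (∫⁻ x, ENNReal.ofReal (‖h x‖ ^ b⁻¹) ∂μ) ^ (θ * b / σ)) ^ σ :=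
        ENNReal.rpow_le_rpow key hσ.le
    _ = _ := by
        rw [ENNReal.mul_rpow_of_nonneg _ _ hσ.le, ← ENNReal.rpow_mul, ← ENNReal.rpow_mul,
          ← ENNReal.rpow_mul, ← ENNReal.rpow_mul]
        congr 2 <;> field_simp

/-- The Hörmander–Paley inequality in terms of norms, with `p = 1 / (1 - α)`. -/
theorem exists_eLpNorm_fourier_paley_le (hu : Measurable u) (hψ : Measurable ψ)
    (hψ0 : ∀ x, 0 ≤ ψ x) (hKt : K ≠ ⊤) (hCt : C ≠ ⊤)
    (hK : ∀ s : ℝ, 0 < s → μ {x | ψ x ≤ s} ≤ K * ENNReal.ofReal s)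
    (hC : μ.map u ≤ C • volume) {α : ℝ} (hα : 0 < α) (hα2 : α < 1 / 2) :
    ∃ c : ℝ≥0∞, c ≠ ⊤ ∧ ∀ f : ℝ → ℂ, Measurable f → Integrable f → MemLp f 2 →
      eLpNorm (fun x ↦ ‖𝓕 f (u x)‖ * ψ x ^ (-(1 - 2 * α))) (ENNReal.ofReal (1 - α))⁻¹ μ
        ≤ c * eLpNorm f (ENNReal.ofReal (1 - α))⁻¹ := by
  have h1α : 0 < 1 - α := by linarith
  have hp : 1 < (1 - α)⁻¹ := (one_lt_inv₀ h1α).2 (by linarith)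
  have hp2 : (1 - α)⁻¹ < 2 := by rw [inv_lt_comm₀ h1α two_pos]; linarith
  set p := (1 - α)⁻¹ with hpd
  set c : ℝ≥0∞ := ENNReal.ofReal p *
    (4 * K * ENNReal.ofReal (p - 1)⁻¹ + 4 * C * ENNReal.ofReal (2 - p)⁻¹) with hc
  have hct : c ≠ ⊤ := by
    rw [hc]
    refine ENNReal.mul_ne_top ENNReal.ofReal_ne_top (ENNReal.add_ne_top.2 ⟨?_, ?_⟩) <;>
    exact ENNReal.mul_ne_top (ENNReal.mul_ne_top (by simp) ‹_›) ENNReal.ofReal_ne_top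
  refine ⟨c ^ (1 - α), ENNReal.rpow_ne_top_of_nonneg h1α.le hct, fun f hfm hf hf2 ↦ ?_⟩
  rw [eLpNorm_inv_ofReal h1α, eLpNorm_inv_ofReal h1α, ← ENNReal.mul_rpow_of_nonneg _ _ h1α.le]
  refine ENNReal.rpow_le_rpow ?_ h1α.le
  refine le_trans (le_of_eq ?_) (lintegral_fourier_rpow_mul_le hu hψ hψ0 hK hC hp hp2 hfm hf hf2)
  refine lintegral_congr fun x ↦ ?_
  rw [← hpd, Real.norm_of_nonneg (mul_nonneg (norm_nonneg _) (Real.rpow_nonneg (hψ0 x) _)),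
    Real.mul_rpow (norm_nonneg _) (Real.rpow_nonneg (hψ0 x) _), ← Real.rpow_mul (hψ0 x)]
  congr 3
  rw [hpd]; field_simp; ring

/-- The Hausdorff–Young inequality, with `p = 1 / (1 - α)` and `p' = 1 / α`. It is the
Hörmander–Paley inequality for the weight `ψ = A |𝓕 f (u)|^{-p'}`, `A = ∫ |𝓕 f (u)|^{p'} dμ`, whose
sublevel sets are controlled by Chebyshev's inequality. -/
theorem exists_eLpNorm_fourier_hausdorffYoung_le (hu : Measurable u) (hCt : C ≠ ⊤)
    (hC : μ.map u ≤ C • volume) {α : ℝ} (hα : 0 < α) (hα2 : α < 1 / 2) :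
    ∃ c : ℝ≥0∞, c ≠ ⊤ ∧ ∀ f : ℝ → ℂ, Measurable f → Integrable f → MemLp f 2 →
      eLpNorm (fun x ↦ 𝓕 f (u x)) (ENNReal.ofReal α)⁻¹ μ
        ≤ c * eLpNorm f (ENNReal.ofReal (1 - α))⁻¹ := by
  have h1α : 0 < 1 - α := by linarith
  have hp : 1 < (1 - α)⁻¹ := (one_lt_inv₀ h1α).2 (by linarith)
  have hp2 : (1 - α)⁻¹ < 2 := by rw [inv_lt_comm₀ h1α two_pos]; linarith
  set p := (1 - α)⁻¹ with hpd
  set q := α⁻¹ with hqd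
  have hq2 : 2 ≤ q := by rw [hqd, le_inv_comm₀ two_pos hα]; linarith
  have hq0 : 0 < q := by linarith
  set c : ℝ≥0∞ := ENNReal.ofReal p *
    (4 * 1 * ENNReal.ofReal (p - 1)⁻¹ + 4 * C * ENNReal.ofReal (2 - p)⁻¹) with hc
  have hct : c ≠ ⊤ := by
    rw [hc]
    refine ENNReal.mul_ne_top ENNReal.ofReal_ne_top (ENNReal.add_ne_top.2 ⟨?_, ?_⟩)
    · exact ENNReal.mul_ne_top (by simp) ENNReal.ofReal_ne_top
    · exact ENNReal.mul_ne_top (ENNReal.mul_ne_top (by simp) ‹_›) ENNReal.ofReal_ne_top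
  refine ⟨c ^ (1 - α), ENNReal.rpow_ne_top_of_nonneg h1α.le hct, fun f hfm hf hf2 ↦ ?_⟩
  have hcont : Continuous (𝓕 f) := continuous_fourier_of_integrable hf
  have hFm : Measurable fun x ↦ ‖𝓕 f (u x)‖ := (hcont.measurable.comp hu).norm
  rw [eLpNorm_inv_ofReal hα, eLpNorm_inv_ofReal h1α, ← ENNReal.mul_rpow_of_nonneg _ _ h1α.le,
    ← hqd, ← hpd]
  set A := ∫⁻ x, ENNReal.ofReal (‖𝓕 f (u x)‖ ^ q) ∂μ with hA
  have hAt : A ≠ ⊤ := by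
    set M := ∫ y, ‖f y‖ with hM
    have h1 : A ≤ ENNReal.ofReal (M ^ (q - 2)) * ∫⁻ x, ‖𝓕 f (u x)‖ₑ ^ 2 ∂μ := by
      rw [← lintegral_const_mul' _ _ ENNReal.ofReal_ne_top]
      refine lintegral_mono fun x ↦ ?_
      rw [← ofReal_norm, ← ENNReal.ofReal_pow (norm_nonneg _),
        ← ENNReal.ofReal_mul (Real.rpow_nonneg (integral_nonneg fun _ ↦ norm_nonneg _) _)]
      refine ENNReal.ofReal_le_ofReal ?_
      calc ‖𝓕 f (u x)‖ ^ q = ‖𝓕 f (u x)‖ ^ (q - 2) * ‖𝓕 f (u x)‖ ^ 2 := by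
            rw [← Real.rpow_natCast, ← Real.rpow_add_of_nonneg (norm_nonneg _) (by linarith)
              (by norm_num)]
            norm_num
        _ ≤ _ := by
            gcongr
            exact norm_fourier_le_integral_norm f (u x)
    refine ne_top_of_le_ne_top (ENNReal.mul_ne_top ENNReal.ofReal_ne_top ?_) h1
    have h2 : ∫⁻ x, ‖𝓕 f (u x)‖ₑ ^ 2 ∂μ ≤ C * ∫⁻ y, ‖f y‖ₑ ^ 2 := by
      calc ∫⁻ x, ‖𝓕 f (u x)‖ₑ ^ 2 ∂μ = ∫⁻ y, ‖𝓕 f y‖ₑ ^ 2 ∂(μ.map u) := by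
            rw [lintegral_map (hcont.measurable.enorm.pow_const 2) hu]
        _ ≤ ∫⁻ y, ‖𝓕 f y‖ₑ ^ 2 ∂(C • volume) := lintegral_mono' hC le_rfl
        _ = _ := by rw [lintegral_smul_measure, smul_eq_mul, lintegral_fourier_sq_eq hf hf2]
    refine ne_top_of_le_ne_top (ENNReal.mul_ne_top hCt ?_) h2
    have h3 := eLpNorm_lt_top_iff_lintegral_rpow_enorm_lt_top (p := 2) (by simp) (by simp)
      |>.1 hf2.eLpNorm_lt_top
    simpa using h3.ne
  rcases eq_or_ne A 0 with hA0 | hA0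
  · rw [hA0, ENNReal.zero_rpow_of_pos hα]; exact zero_le
  set a := A.toReal with ha
  have ha0 : 0 < a := ENNReal.toReal_pos hA0 hAt
  have hAa : A = ENNReal.ofReal a := (ENNReal.ofReal_toReal hAt).symm
  set S : Set X := {x | ‖𝓕 f (u x)‖ ≠ 0} with hS
  have hSm : MeasurableSet S := hFm (measurableSet_singleton 0).compl
  classical
  set φ : X → ℝ := fun x ↦ if ‖𝓕 f (u x)‖ = 0 then 1 else a * ‖𝓕 f (u x)‖ ^ (-q) with hφ
  have hφm : Measurable φ :=
    Measurable.ite (hFm (measurableSet_singleton 0)) measurable_const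
      ((hFm.pow_const _).const_mul _)
  have hφ0 : ∀ x, 0 ≤ φ x := by
    intro x
    simp only [hφ]
    split_ifs <;> positivity
  have hφK : ∀ s : ℝ, 0 < s → μ.restrict S {x | φ x ≤ s} ≤ 1 * ENNReal.ofReal s := by
    intro s hs
    rw [Measure.restrict_apply (measurableSet_le hφm measurable_const), one_mul]
    have hsub : {x | φ x ≤ s} ∩ S ⊆
        {x | ENNReal.ofReal (a / s) ≤ ENNReal.ofReal (‖𝓕 f (u x)‖ ^ q)} := by
      rintro x ⟨hx, hxS⟩
      have hx : φ x ≤ s := hx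
      have hxS : ‖𝓕 f (u x)‖ ≠ 0 := hxS
      have hpos : 0 < ‖𝓕 f (u x)‖ := lt_of_le_of_ne (norm_nonneg _) hxS.symm
      simp only [hφ, if_neg hxS] at hx
      refine ENNReal.ofReal_le_ofReal ?_
      rw [Real.rpow_neg hpos.le, ← div_eq_mul_inv, div_le_iff₀ (by positivity)] at hx
      rw [div_le_iff₀ hs]
      linarith
    have hch := mul_meas_ge_le_lintegral (μ := μ) (hFm.pow_const q).ennreal_ofReal
      (ENNReal.ofReal (a / s))
    have h5 := (mul_le_mul_right (measure_mono hsub) _).trans hch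
    rw [← hA, hAa, mul_comm, ← ENNReal.le_div_iff_mul_le (Or.inl (by simp; positivity))
      (Or.inl ENNReal.ofReal_ne_top), ← ENNReal.ofReal_div_of_pos (by positivity)] at h5
    convert h5 using 2
    field_simp
  have hmap : (μ.restrict S).map u ≤ C • volume :=
    (Measure.map_mono Measure.restrict_le_self hu).trans hC
  have key := lintegral_fourier_rpow_mul_le hu hφm hφ0 hφK hmap hp hp2 hfm hf hf2
  have hpq : p - q * (p - 2) = q := by
    rw [hpd, hqd]; field_simp; ring
  have hlhs : ∫⁻ x, ENNReal.ofReal (‖𝓕 f (u x)‖ ^ p * φ x ^ (p - 2)) ∂(μ.restrict S)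
      = ENNReal.ofReal (a ^ (p - 2)) * A := by
    have hAS : A = ∫⁻ x in S, ENNReal.ofReal (‖𝓕 f (u x)‖ ^ q) ∂μ := by
      rw [hA, ← lintegral_indicator hSm]
      refine lintegral_congr fun x ↦ ?_
      by_cases hx : ‖𝓕 f (u x)‖ = 0
      · rw [indicator_of_notMem (by simpa [hS] using hx), hx, Real.zero_rpow hq0.ne']; simp
      · rw [indicator_of_mem (show x ∈ S from hx)]
    rw [hAS, ← lintegral_const_mul' _ _ ENNReal.ofReal_ne_top]
    refine setLIntegral_congr_fun hSm fun x hx ↦ ?_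
    have hx : ‖𝓕 f (u x)‖ ≠ 0 := hx
    have hpos : 0 < ‖𝓕 f (u x)‖ := lt_of_le_of_ne (norm_nonneg _) hx.symm
    simp only [hφ, if_neg hx]
    rw [← ENNReal.ofReal_mul (by positivity), Real.mul_rpow ha0.le (by positivity),
      ← Real.rpow_mul hpos.le, mul_left_comm, ← Real.rpow_add hpos,
      show p + -q * (p - 2) = q by linarith]
  rw [hlhs, hAa, ← ENNReal.ofReal_mul (by positivity)] at key
  have hexp : a ^ (p - 2) * a = a ^ (p - 1) := by
    rw [← Real.rpow_add_one ha0.ne']; ring_nf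
  rw [hexp, ← hc] at key
  calc A ^ α = (ENNReal.ofReal (a ^ (p - 1))) ^ (1 - α) := by
        rw [hAa, ENNReal.ofReal_rpow_of_pos ha0, ENNReal.ofReal_rpow_of_pos (by positivity),
          ← Real.rpow_mul ha0.le]
        congr 2
        rw [hpd]; field_simp; ring
    _ ≤ _ := ENNReal.rpow_le_rpow key h1α.le

/-- Pitt's inequality
`‖𝓕 f (u) ψ^(α - σ)‖_{L^{1/σ}(μ)} ≤ c ‖f‖_{L^{1/(1-α)}}` for `α ≤ σ ≤ 1 - α`, interpolating between
the Hausdorff–Young inequality (`σ = α`) and the Hörmander–Paley inequality (`σ = 1 - α`). -/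
theorem exists_eLpNorm_fourier_pitt_le (hu : Measurable u) (hψ : Measurable ψ)
    (hψ0 : ∀ x, 0 ≤ ψ x) (hKt : K ≠ ⊤) (hCt : C ≠ ⊤)
    (hK : ∀ s : ℝ, 0 < s → μ {x | ψ x ≤ s} ≤ K * ENNReal.ofReal s)
    (hC : μ.map u ≤ C • volume) {α σ : ℝ} (hα : 0 < α) (hα2 : α < 1 / 2) (hσ : α ≤ σ)
    (hσ2 : σ ≤ 1 - α) :
    ∃ c : ℝ≥0∞, c ≠ ⊤ ∧ ∀ f : ℝ → ℂ, Measurable f → Integrable f → MemLp f 2 →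
      eLpNorm (fun x ↦ ‖𝓕 f (u x)‖ * ψ x ^ (α - σ)) (ENNReal.ofReal σ)⁻¹ μ
        ≤ c * eLpNorm f (ENNReal.ofReal (1 - α))⁻¹ := by
  obtain ⟨c₁, hc₁, h₁⟩ := exists_eLpNorm_fourier_hausdorffYoung_le hu hCt hC hα hα2
  obtain ⟨c₂, hc₂, h₂⟩ := exists_eLpNorm_fourier_paley_le hu hψ hψ0 hKt hCt hK hC hα hα2
  have hd : 0 < 1 - 2 * α := by linarith
  obtain ⟨θ, hθd, hθ0, hθ1⟩ : ∃ θ : ℝ, θ * (1 - 2 * α) = σ - α ∧ 0 ≤ θ ∧ θ ≤ 1 :=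
    ⟨(σ - α) / (1 - 2 * α), div_mul_cancel₀ _ hd.ne', div_nonneg (by linarith) hd.le,
      (div_le_one hd).2 (by linarith)⟩
  have hθ' : 0 ≤ 1 - θ := by linarith
  refine ⟨c₁ ^ (1 - θ) * c₂ ^ θ, ENNReal.mul_ne_top (ENNReal.rpow_ne_top_of_nonneg hθ' hc₁)
    (ENNReal.rpow_ne_top_of_nonneg hθ0 hc₂), fun f hfm hf hf2 ↦ ?_⟩
  have hcont : Continuous (𝓕 f) := continuous_fourier_of_integrable hf
  have hFm : Measurable fun x ↦ ‖𝓕 f (u x)‖ := (hcont.measurable.comp hu).norm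
  have key := eLpNorm_rpow_mul_rpow_le (μ := μ) (g := fun x ↦ ‖𝓕 f (u x)‖)
    (h := fun x ↦ ‖𝓕 f (u x)‖ * ψ x ^ (-(1 - 2 * α))) hFm
    (hFm.mul (hψ.pow_const (-(1 - 2 * α))))
    (fun x ↦ norm_nonneg _) (fun x ↦ mul_nonneg (norm_nonneg _) (Real.rpow_nonneg (hψ0 x) _))
    hα (by linarith : 0 < 1 - α) hθ0 hθ1
  have hfun : ∀ x, ‖𝓕 f (u x)‖ ^ (1 - θ) * (‖𝓕 f (u x)‖ * ψ x ^ (-(1 - 2 * α))) ^ θ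
      = ‖𝓕 f (u x)‖ * ψ x ^ (α - σ) := by
    intro x
    rw [Real.mul_rpow (norm_nonneg _) (Real.rpow_nonneg (hψ0 x) _), ← mul_assoc,
      ← Real.rpow_add_of_nonneg (norm_nonneg _) hθ' hθ0, ← Real.rpow_mul (hψ0 x),
      show -(1 - 2 * α) * θ = α - σ by linarith, sub_add_cancel, Real.rpow_one]
  rw [show (1 - θ) * α + θ * (1 - α) = σ by linarith, funext hfun, eLpNorm_norm] at key
  refine key.trans ((mul_le_mul' (ENNReal.rpow_le_rpow (h₁ f hfm hf hf2) hθ')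
    (ENNReal.rpow_le_rpow (h₂ f hfm hf hf2) hθ0)).trans (le_of_eq ?_))
  generalize eLpNorm f (ENNReal.ofReal (1 - α))⁻¹ = N
  rw [ENNReal.mul_rpow_of_nonneg _ _ hθ', ENNReal.mul_rpow_of_nonneg _ _ hθ0,
    mul_mul_mul_comm, ← ENNReal.rpow_add_of_nonneg _ _ hθ' hθ0, sub_add_cancel,
    ENNReal.rpow_one]

end Pitt

/-! ### Trilinear estimates near a degenerate direction -/

section Trilinear

variable {X : Type*} [MeasurableSpace X] {τ : Measure X} {u u₁ u₂ u₃ m : X → ℝ} {K C : ℝ≥0∞}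

theorem eLpNorm_fourier_top_le (τ : Measure X) (u : X → ℝ) {f : ℝ → ℂ} (hf : Integrable f) :
    eLpNorm (fun x ↦ 𝓕 f (u x)) ⊤ τ ≤ eLpNorm f 1 := by
  have h1 : eLpNorm f 1 = ENNReal.ofReal (∫ y, ‖f y‖) := by
    rw [eLpNorm_one_eq_lintegral_enorm, ofReal_integral_norm_eq_lintegral_enorm hf]
  rw [h1, eLpNorm_exponent_top]
  exact eLpNormEssSup_le_of_ae_bound (.of_forall fun x ↦ norm_fourier_le_integral_norm f (u x))

/-- Hölder's inequality for three functions on a finite measure space. -/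
theorem lintegral_enorm_mul_mul_le [IsFiniteMeasure τ] {g₁ g₂ g₃ : X → ℝ} (h₁ : Measurable g₁)
    (h₂ : Measurable g₂) (h₃ : Measurable g₃) {σ₁ σ₂ σ₃ : ℝ} (hσ₁ : 0 ≤ σ₁) (hσ₂ : 0 ≤ σ₂)
    (hσ₃ : 0 ≤ σ₃) (hσ : σ₁ + σ₂ + σ₃ ≤ 1) :
    ∫⁻ x, ‖g₁ x * g₂ x * g₃ x‖ₑ ∂τ ≤ τ univ ^ (1 - (σ₁ + σ₂ + σ₃)) *
      (eLpNorm g₁ (ENNReal.ofReal σ₁)⁻¹ τ * eLpNorm g₂ (ENNReal.ofReal σ₂)⁻¹ τ *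
        eLpNorm g₃ (ENNReal.ofReal σ₃)⁻¹ τ) := by
  have i1 : (ENNReal.ofReal σ₁)⁻¹.HolderTriple (ENNReal.ofReal σ₂)⁻¹
      (ENNReal.ofReal (σ₁ + σ₂))⁻¹ := ⟨by simp [ENNReal.ofReal_add hσ₁ hσ₂]⟩
  have i2 : (ENNReal.ofReal (σ₁ + σ₂))⁻¹.HolderTriple (ENNReal.ofReal σ₃)⁻¹
      (ENNReal.ofReal (σ₁ + σ₂ + σ₃))⁻¹ :=
    ⟨by simp [ENNReal.ofReal_add (add_nonneg hσ₁ hσ₂) hσ₃]⟩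
  have hle : (1 : ℝ≥0∞) ≤ (ENNReal.ofReal (σ₁ + σ₂ + σ₃))⁻¹ := by
    rw [ENNReal.one_le_inv]; exact ENNReal.ofReal_le_one.2 hσ
  have e1 := eLpNorm_le_eLpNorm_mul_rpow_measure_univ (μ := τ) hle
    ((h₁.mul h₂).mul h₃).aestronglyMeasurable
  have e2 := eLpNorm_smul_le_mul_eLpNorm (μ := τ) h₃.aestronglyMeasurable
    (h₁.mul h₂).aestronglyMeasurable (hpqr := i2)
  have e3 := eLpNorm_smul_le_mul_eLpNorm (μ := τ) h₂.aestronglyMeasurable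
    h₁.aestronglyMeasurable (hpqr := i1)
  have hexp : 1 / (1 : ℝ≥0∞).toReal - 1 / ((ENNReal.ofReal (σ₁ + σ₂ + σ₃))⁻¹).toReal
      = 1 - (σ₁ + σ₂ + σ₃) := by
    rw [ENNReal.toReal_inv, ENNReal.toReal_ofReal (by positivity)]; simp
  rw [hexp, eLpNorm_one_eq_lintegral_enorm] at e1
  refine e1.trans ?_
  rw [mul_comm]
  exact mul_le_mul_right (e2.trans (mul_le_mul_left e3 _)) _

theorem ae_pos_of_sublevel_le (hKt : K ≠ ⊤)
    (hK : ∀ s : ℝ, 0 < s → τ {x | m x ≤ s} ≤ K * ENNReal.ofReal s) : ∀ᵐ x ∂τ, 0 < m x := by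
  have hsub : ∀ s : ℝ, 0 < s → τ {x | ¬ 0 < m x} ≤ K * ENNReal.ofReal s := fun s hs ↦
    (measure_mono fun x (hx : ¬ 0 < m x) ↦ (not_lt.1 hx).trans hs.le).trans (hK s hs)
  rw [ae_iff]
  by_contra hne
  have hlim : Filter.Tendsto (fun s : ℝ ↦ K * ENNReal.ofReal s) (nhdsWithin 0 (Ioi 0))
      (nhds (K * ENNReal.ofReal 0)) :=
    (ENNReal.Tendsto.const_mul (ENNReal.tendsto_ofReal Filter.tendsto_id) (Or.inr hKt)).mono_left
      nhdsWithin_le_nhds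
  have := ge_of_tendsto hlim (eventually_nhdsWithin_of_forall hsub)
  simp only [ENNReal.ofReal_zero, mul_zero, nonpos_iff_eq_zero] at this
  exact hne this

/-- Negative powers `m^(-b)` of a function with `τ {m ≤ s} ≤ K s` belong to `L^{1/σ}` for
`b < σ`. -/
theorem eLpNorm_rpow_neg_ne_top [IsFiniteMeasure τ] (hm : Measurable m) (hm0 : ∀ x, 0 ≤ m x)
    (hKt : K ≠ ⊤) (hK : ∀ s : ℝ, 0 < s → τ {x | m x ≤ s} ≤ K * ENNReal.ofReal s)
    {b σ : ℝ} (hb : 0 < b) (hbσ : b < σ) :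
    eLpNorm (fun x ↦ m x ^ (-b)) (ENNReal.ofReal σ)⁻¹ τ ≠ ⊤ := by
  have hσ : 0 < σ := hb.trans hbσ
  rw [eLpNorm_inv_ofReal hσ]
  refine ENNReal.rpow_ne_top_of_nonneg hσ.le ?_
  set κ := b / σ with hκ
  have hκ0 : 0 < κ := by positivity
  have hκ1 : κ < 1 := (div_lt_one hσ).2 hbσ
  have h1 : ∫⁻ x, ENNReal.ofReal (‖m x ^ (-b)‖ ^ σ⁻¹) ∂τ
      = ∫⁻ x, ENNReal.ofReal ((m x)⁻¹ ^ κ) ∂τ := by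
    refine lintegral_congr fun x ↦ ?_
    rw [Real.norm_of_nonneg (Real.rpow_nonneg (hm0 x) _), ← Real.rpow_mul (hm0 x),
      Real.inv_rpow (hm0 x), ← Real.rpow_neg (hm0 x), hκ, div_eq_mul_inv, neg_mul]
  rw [h1, lintegral_rpow_eq_lintegral_meas_lt_mul τ
    (Filter.Eventually.of_forall fun x ↦ inv_nonneg.2 (hm0 x)) hm.inv.aemeasurable hκ0]
  refine ENNReal.mul_ne_top ENNReal.ofReal_ne_top ?_
  have hsplit : Ioi (0 : ℝ) ⊆ Ioo 0 1 ∪ {1} ∪ Ioi 1 := by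
    intro t ht
    rcases lt_trichotomy t 1 with h | h | h
    · exact Or.inl (Or.inl ⟨ht, h⟩)
    · exact Or.inl (Or.inr h)
    · exact Or.inr h
  refine ne_top_of_le_ne_top ?_ ((lintegral_mono_set hsplit).trans
    ((lintegral_union_le _ _ _).trans (add_le_add_left (lintegral_union_le _ _ _) _)))
  have hb1 : ∫⁻ t in Ioo (0 : ℝ) 1, τ {a | t < (m a)⁻¹} * ENNReal.ofReal (t ^ (κ - 1)) ≠ ⊤ := by
    refine ne_top_of_le_ne_top ?_ (lintegral_mono (g := fun t ↦
      τ univ * ENNReal.ofReal (t ^ ((κ + 1) - 2))) fun t ↦ ?_)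
    · rw [lintegral_const_mul' _ _ (measure_ne_top _ _),
        lintegral_Ioo_rpow_sub_two (by linarith) zero_le_one]
      exact ENNReal.mul_ne_top (measure_ne_top _ _) ENNReal.ofReal_ne_top
    · rw [show κ + 1 - 2 = κ - 1 by ring]
      exact mul_le_mul_left (measure_mono (subset_univ _)) _
  have hb2 : ∫⁻ t in Ioi (1 : ℝ), τ {a | t < (m a)⁻¹} * ENNReal.ofReal (t ^ (κ - 1)) ≠ ⊤ := by
    refine ne_top_of_le_ne_top ?_ (setLIntegral_mono' (g := fun t ↦
      K * ENNReal.ofReal (t ^ ((κ + 1) - 3))) measurableSet_Ioi fun t ht ↦ ?_)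
    · rw [lintegral_const_mul' _ _ hKt, lintegral_Ioi_rpow_sub_three (by linarith) zero_lt_one]
      exact ENNReal.mul_ne_top hKt ENNReal.ofReal_ne_top
    · have ht0 : 0 < t := zero_lt_one.trans ht
      have hsub : {a | t < (m a)⁻¹} ⊆ {a | m a ≤ t⁻¹} := by
        intro x hx
        have hx : t < (m x)⁻¹ := hx
        have hmx : 0 < m x := inv_pos.1 (ht0.trans hx)
        exact ((lt_inv_comm₀ ht0 hmx).1 hx).le
      calc τ {a | t < (m a)⁻¹} * ENNReal.ofReal (t ^ (κ - 1))
          ≤ K * ENNReal.ofReal t⁻¹ * ENNReal.ofReal (t ^ (κ - 1)) :=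
            mul_le_mul_left ((measure_mono hsub).trans (hK _ (inv_pos.2 ht0))) _
        _ = K * ENNReal.ofReal (t ^ ((κ + 1) - 3)) := by
            rw [mul_assoc, ← ENNReal.ofReal_mul (by positivity), ← Real.rpow_neg_one,
              ← Real.rpow_add ht0]
            ring_nf
  refine ENNReal.add_ne_top.2 ⟨ENNReal.add_ne_top.2 ⟨hb1, ?_⟩, hb2⟩
  simp

/-- Hausdorff–Young along a map with bounded density, including the endpoint `α = 0`. -/
theorem exists_eLpNorm_fourier_le (hu : Measurable u) (hCt : C ≠ ⊤)
    (hC : τ.map u ≤ C • volume) {α : ℝ} (hα : 0 ≤ α) (hα2 : α < 1 / 2) :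
    ∃ c : ℝ≥0∞, c ≠ ⊤ ∧ ∀ f : ℝ → ℂ, Measurable f → Integrable f → MemLp f 2 →
      eLpNorm (fun x ↦ ‖𝓕 f (u x)‖) (ENNReal.ofReal α)⁻¹ τ
        ≤ c * eLpNorm f (ENNReal.ofReal (1 - α))⁻¹ := by
  rcases hα.eq_or_lt with rfl | hα
  · refine ⟨1, by simp, fun f _ hf _ ↦ ?_⟩
    rw [eLpNorm_norm]
    simpa using eLpNorm_fourier_top_le τ u hf
  · simpa only [eLpNorm_norm] using exists_eLpNorm_fourier_hausdorffYoung_le hu hCt hC hα hα2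

/-- Pitt's inequality along a map `u` with a fold, where `m` plays the role of `|u'|`: for the
measure `m τ` and the weight `ψ = m²` it becomes an estimate with respect to `τ`. -/
theorem exists_eLpNorm_fourier_fold_le (hu : Measurable u) (hm : Measurable m)
    (hm0 : ∀ x, 0 ≤ m x) (hKt : K ≠ ⊤) (hCt : C ≠ ⊤)
    (hK : ∀ s : ℝ, 0 < s → τ {x | m x ≤ s} ≤ K * ENNReal.ofReal s)
    (hC : (τ.withDensity fun x ↦ ENNReal.ofReal (m x)).map u ≤ C • volume)
    {α σ : ℝ} (hα : 0 < α) (hα2 : α < 1 / 2) (hσ : α ≤ σ) (hσ2 : σ ≤ 1 - α) :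
    ∃ c : ℝ≥0∞, c ≠ ⊤ ∧ ∀ f : ℝ → ℂ, Measurable f → Integrable f → MemLp f 2 →
      eLpNorm (fun x ↦ ‖𝓕 f (u x)‖ * m x ^ (2 * α - σ)) (ENNReal.ofReal σ)⁻¹ τ
        ≤ c * eLpNorm f (ENNReal.ofReal (1 - α))⁻¹ := by
  have hK' : ∀ s : ℝ, 0 < s → (τ.withDensity fun x ↦ ENNReal.ofReal (m x)) {x | m x ^ 2 ≤ s}
      ≤ K * ENNReal.ofReal s := by
    intro s hs
    have hs' : 0 < √s := Real.sqrt_pos.2 hs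
    have heq : {x | m x ^ 2 ≤ s} = {x | m x ≤ √s} := by
      ext x; exact (Real.le_sqrt (hm0 x) hs.le).symm
    have hms : MeasurableSet {x | m x ≤ √s} := measurableSet_le hm measurable_const
    rw [heq, withDensity_apply _ hms]
    calc ∫⁻ x in {x | m x ≤ √s}, ENNReal.ofReal (m x) ∂τ
        ≤ ∫⁻ _ in {x | m x ≤ √s}, ENNReal.ofReal √s ∂τ :=
          setLIntegral_mono' hms fun x hx ↦ ENNReal.ofReal_le_ofReal hx
      _ = ENNReal.ofReal √s * τ {x | m x ≤ √s} := by rw [setLIntegral_const]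
      _ ≤ ENNReal.ofReal √s * (K * ENNReal.ofReal √s) := mul_le_mul_right (hK _ hs') _
      _ = K * ENNReal.ofReal s := by
          rw [mul_left_comm, ← ENNReal.ofReal_mul hs'.le, Real.mul_self_sqrt hs.le]
  obtain ⟨c, hc, h⟩ := exists_eLpNorm_fourier_pitt_le hu (hm.pow_const 2) (fun x ↦ sq_nonneg (m x))
    hKt hCt hK' hC hα hα2 hσ hσ2
  refine ⟨c, hc, fun f hfm hf hf2 ↦ le_trans (le_of_eq ?_) (h f hfm hf hf2)⟩
  have hcont : Continuous (𝓕 f) := continuous_fourier_of_integrable hf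
  have hFm : Measurable fun x ↦ ‖𝓕 f (u x)‖ := (hcont.measurable.comp hu).norm
  have hσ0 : 0 < σ := hα.trans_le hσ
  rw [eLpNorm_inv_ofReal hσ0, eLpNorm_inv_ofReal hσ0,
    lintegral_withDensity_eq_lintegral_mul _ hm.ennreal_ofReal (by fun_prop)]
  congr 1
  refine lintegral_congr_ae ?_
  filter_upwards [ae_pos_of_sublevel_le hKt hK] with x hx
  simp only [Pi.mul_apply]
  rw [← ENNReal.ofReal_mul hx.le, Real.norm_of_nonneg (by positivity),
    Real.norm_of_nonneg (by positivity), Real.mul_rpow (norm_nonneg _) (by positivity),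
    Real.mul_rpow (norm_nonneg _) (by positivity), mul_left_comm]
  congr 2
  rw [← Real.rpow_natCast, ← Real.rpow_mul hx.le, ← Real.rpow_mul hx.le, ← Real.rpow_mul hx.le]
  nth_rewrite 2 [← Real.rpow_one (m x)]
  rw [← Real.rpow_add hx]
  congr 1
  push_cast
  field_simp
  ring

theorem mul_mul_mul_comm_three (D a b c x y z : ℝ≥0∞) :
    D * (a * x * (b * y) * (c * z)) = D * (a * b * c) * (x * y * z) := by
  ring

/-- The trilinear estimate on a piece where only `u₁` folds, for `α > 1 / 3` and `β > 0`. -/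
theorem exists_lintegral_fourier_le_of_third_lt [IsFiniteMeasure τ] (hu₁ : Measurable u₁)
    (hu₂ : Measurable u₂) (hu₃ : Measurable u₃) (hm : Measurable m)
    (hm0 : ∀ x, 0 ≤ m x) {M : ℝ} (hM : ∀ x, m x ≤ M) (hKt : K ≠ ⊤) (hCt : C ≠ ⊤)
    (hK : ∀ s : ℝ, 0 < s → τ {x | m x ≤ s} ≤ K * ENNReal.ofReal s)
    (hC₁ : (τ.withDensity fun x ↦ ENNReal.ofReal (m x)).map u₁ ≤ C • volume)
    (hC₂ : τ.map u₂ ≤ C • volume) (hC₃ : τ.map u₃ ≤ C • volume)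
    {α β γ : ℝ} (hα : 1 / 3 < α) (hα2 : α < 1 / 2) (hβ : 0 < β) (hβ2 : β < 1 / 2) (hγ : 0 ≤ γ)
    (hγ2 : γ < 1 / 2) (hsum : 2 * α + β + γ ≤ 1) :
    ∃ c : ℝ≥0∞, c ≠ ⊤ ∧ ∀ f g h : ℝ → ℂ, Measurable f → Integrable f → MemLp f 2 →
      Measurable g → Integrable g → MemLp g 2 → Measurable h → Integrable h → MemLp h 2 →
      ∫⁻ x, ‖𝓕 f (u₁ x)‖ₑ * ‖𝓕 g (u₂ x)‖ₑ * ‖𝓕 h (u₃ x)‖ₑ ∂τ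
        ≤ c * (eLpNorm f (ENNReal.ofReal (1 - α))⁻¹ * eLpNorm g (ENNReal.ofReal (1 - β))⁻¹ *
          eLpNorm h (ENNReal.ofReal (1 - γ))⁻¹) := by
  obtain ⟨c₁, hc₁, h₁⟩ := exists_eLpNorm_fourier_fold_le hu₁ hm hm0 hKt hCt hK hC₁
    (by linarith : 0 < α) hα2 (by linarith : α ≤ 1 - α) le_rfl
  obtain ⟨c₂, hc₂, h₂⟩ := exists_eLpNorm_fourier_pitt_le hu₂ hm hm0 hKt hCt hK hC₂ hβ hβ2
    (by linarith : β ≤ α - γ) (by linarith)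
  obtain ⟨c₃, hc₃, h₃⟩ := exists_eLpNorm_fourier_le hu₃ hCt hC₃ hγ hγ2
  set e := 1 - 2 * α - β - γ with he
  have he0 : 0 ≤ e := by linarith
  set D := ENNReal.ofReal (M ^ e) * τ univ ^ (1 - ((1 - α) + (α - γ) + γ)) with hD
  have hDt : D ≠ ⊤ := ENNReal.mul_ne_top ENNReal.ofReal_ne_top
    (ENNReal.rpow_ne_top_of_nonneg (by linarith) (measure_ne_top _ _))
  refine ⟨D * (c₁ * c₂ * c₃), ENNReal.mul_ne_top hDt (ENNReal.mul_ne_top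
    (ENNReal.mul_ne_top hc₁ hc₂) hc₃), fun f g h hfm hf hf2 hgm hg hg2 hhm hh hh2 ↦ ?_⟩
  have hF : Measurable fun x ↦ ‖𝓕 f (u₁ x)‖ :=
    ((continuous_fourier_of_integrable hf).measurable.comp hu₁).norm
  have hG : Measurable fun x ↦ ‖𝓕 g (u₂ x)‖ :=
    ((continuous_fourier_of_integrable hg).measurable.comp hu₂).norm
  have hH : Measurable fun x ↦ ‖𝓕 h (u₃ x)‖ :=
    ((continuous_fourier_of_integrable hh).measurable.comp hu₃).norm
  have key := lintegral_enorm_mul_mul_le (τ := τ) (hF.mul (hm.pow_const (2 * α - (1 - α))))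
    (hG.mul (hm.pow_const (β - (α - γ)))) hH (by linarith : 0 ≤ 1 - α)
    (by linarith : 0 ≤ α - γ) hγ (by linarith)
  calc ∫⁻ x, ‖𝓕 f (u₁ x)‖ₑ * ‖𝓕 g (u₂ x)‖ₑ * ‖𝓕 h (u₃ x)‖ₑ ∂τ
      ≤ ∫⁻ x, ENNReal.ofReal (M ^ e) * ‖(‖𝓕 f (u₁ x)‖ * m x ^ (2 * α - (1 - α))) *
          (‖𝓕 g (u₂ x)‖ * m x ^ (β - (α - γ))) * ‖𝓕 h (u₃ x)‖‖ₑ ∂τ := by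
        refine lintegral_mono_ae ?_
        filter_upwards [ae_pos_of_sublevel_le hKt hK] with x hx
        have hw : 1 ≤ M ^ e * (m x ^ (2 * α - (1 - α)) * m x ^ (β - (α - γ))) := by
          calc (1 : ℝ) = m x ^ e * (m x ^ (2 * α - (1 - α)) * m x ^ (β - (α - γ))) := by
                rw [← Real.rpow_add hx, ← Real.rpow_add hx]
                simp only [he]
                ring_nf
                simp
            _ ≤ _ := by
                gcongr
                exact hM x
        simp only [← ofReal_norm]
        have hM0 : 0 ≤ M := (hm0 x).trans (hM x)
        rw [← ENNReal.ofReal_mul (norm_nonneg _), ← ENNReal.ofReal_mul (by positivity),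
          ← ENNReal.ofReal_mul (by positivity), Real.norm_of_nonneg (by positivity)]
        refine ENNReal.ofReal_le_ofReal ?_
        calc ‖𝓕 f (u₁ x)‖ * ‖𝓕 g (u₂ x)‖ * ‖𝓕 h (u₃ x)‖
            ≤ ‖𝓕 f (u₁ x)‖ * ‖𝓕 g (u₂ x)‖ * ‖𝓕 h (u₃ x)‖ *
              (M ^ e * (m x ^ (2 * α - (1 - α)) * m x ^ (β - (α - γ)))) :=
              le_mul_of_one_le_right (by positivity) hw
          _ = _ := by ring
    _ ≤ ENNReal.ofReal (M ^ e) * (τ univ ^ (1 - ((1 - α) + (α - γ) + γ)) *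
          ((c₁ * eLpNorm f (ENNReal.ofReal (1 - α))⁻¹) *
            (c₂ * eLpNorm g (ENNReal.ofReal (1 - β))⁻¹) *
            (c₃ * eLpNorm h (ENNReal.ofReal (1 - γ))⁻¹))) := by
        rw [lintegral_const_mul' _ _ ENNReal.ofReal_ne_top]
        refine mul_le_mul_right (key.trans (mul_le_mul_right ?_ _)) _
        exact mul_le_mul' (mul_le_mul' (h₁ f hfm hf hf2) (h₂ g hgm hg hg2)) (h₃ h hhm hh hh2)
    _ = _ := by rw [← mul_assoc, ← hD, mul_mul_mul_comm_three]

/-- The trilinear estimate on a piece where only `u₁` folds, for `α ≤ 1 / 3`. -/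
theorem exists_lintegral_fourier_le_of_le_third [IsFiniteMeasure τ] (hu₁ : Measurable u₁)
    (hu₂ : Measurable u₂) (hu₃ : Measurable u₃) (hm : Measurable m)
    (hm0 : ∀ x, 0 ≤ m x) (hKt : K ≠ ⊤) (hCt : C ≠ ⊤)
    (hK : ∀ s : ℝ, 0 < s → τ {x | m x ≤ s} ≤ K * ENNReal.ofReal s)
    (hC₁ : (τ.withDensity fun x ↦ ENNReal.ofReal (m x)).map u₁ ≤ C • volume)
    (hC₂ : τ.map u₂ ≤ C • volume) (hC₃ : τ.map u₃ ≤ C • volume)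
    {α β γ : ℝ} (hα : 0 ≤ α) (hα3 : α ≤ 1 / 3) (hβ : 0 ≤ β) (hβ2 : β < 1 / 2) (hγ : 0 ≤ γ)
    (hγ2 : γ < 1 / 2) (hsum : 2 * α + β + γ ≤ 1) :
    ∃ c : ℝ≥0∞, c ≠ ⊤ ∧ ∀ f g h : ℝ → ℂ, Measurable f → Integrable f → MemLp f 2 →
      Measurable g → Integrable g → MemLp g 2 → Measurable h → Integrable h → MemLp h 2 →
      ∫⁻ x, ‖𝓕 f (u₁ x)‖ₑ * ‖𝓕 g (u₂ x)‖ₑ * ‖𝓕 h (u₃ x)‖ₑ ∂τ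
        ≤ c * (eLpNorm f (ENNReal.ofReal (1 - α))⁻¹ * eLpNorm g (ENNReal.ofReal (1 - β))⁻¹ *
          eLpNorm h (ENNReal.ofReal (1 - γ))⁻¹) := by
  have hα2 : α < 1 / 2 := by linarith
  obtain ⟨c₁, hc₁, h₁⟩ : ∃ c : ℝ≥0∞, c ≠ ⊤ ∧ ∀ f : ℝ → ℂ, Measurable f → Integrable f →
      MemLp f 2 → eLpNorm (fun x ↦ ‖𝓕 f (u₁ x)‖) (ENNReal.ofReal (2 * α))⁻¹ τ
        ≤ c * eLpNorm f (ENNReal.ofReal (1 - α))⁻¹ := by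
    rcases hα.eq_or_lt with rfl | hα0
    · refine ⟨1, by simp, fun f _ hf _ ↦ ?_⟩
      rw [eLpNorm_norm]
      simpa using eLpNorm_fourier_top_le τ u₁ hf
    · simpa using exists_eLpNorm_fourier_fold_le hu₁ hm hm0 hKt hCt hK hC₁ hα0 hα2
        (by linarith : α ≤ 2 * α) (by linarith)
  obtain ⟨c₂, hc₂, h₂⟩ := exists_eLpNorm_fourier_le hu₂ hCt hC₂ hβ hβ2
  obtain ⟨c₃, hc₃, h₃⟩ := exists_eLpNorm_fourier_le hu₃ hCt hC₃ hγ hγ2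
  refine ⟨τ univ ^ (1 - (2 * α + β + γ)) * (c₁ * c₂ * c₃), ENNReal.mul_ne_top
    (ENNReal.rpow_ne_top_of_nonneg (by linarith) (measure_ne_top _ _)) (ENNReal.mul_ne_top
      (ENNReal.mul_ne_top hc₁ hc₂) hc₃), fun f g h hfm hf hf2 hgm hg hg2 hhm hh hh2 ↦ ?_⟩
  have hF : Measurable fun x ↦ ‖𝓕 f (u₁ x)‖ :=
    ((continuous_fourier_of_integrable hf).measurable.comp hu₁).norm
  have hG : Measurable fun x ↦ ‖𝓕 g (u₂ x)‖ :=
    ((continuous_fourier_of_integrable hg).measurable.comp hu₂).norm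
  have hH : Measurable fun x ↦ ‖𝓕 h (u₃ x)‖ :=
    ((continuous_fourier_of_integrable hh).measurable.comp hu₃).norm
  have key := lintegral_enorm_mul_mul_le (τ := τ) hF hG hH (by linarith : 0 ≤ 2 * α) hβ hγ hsum
  simp only [enorm_mul, enorm_norm] at key
  have k2 := mul_le_mul' (mul_le_mul' (h₁ f hfm hf hf2) (h₂ g hgm hg hg2)) (h₃ h hhm hh hh2)
  rw [← mul_mul_mul_comm_three]
  exact key.trans (mul_le_mul_right k2 _)

/-- The trilinear estimate on a piece where only `u₁` folds, for `α > 1 / 3` and `β = γ = 0`. -/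
theorem exists_lintegral_fourier_le_of_third_lt_of_zero [IsFiniteMeasure τ] (hu₁ : Measurable u₁)
    (hu₂ : Measurable u₂) (hu₃ : Measurable u₃) (hm : Measurable m)
    (hm0 : ∀ x, 0 ≤ m x) (hKt : K ≠ ⊤) (hCt : C ≠ ⊤)
    (hK : ∀ s : ℝ, 0 < s → τ {x | m x ≤ s} ≤ K * ENNReal.ofReal s)
    (hC₁ : (τ.withDensity fun x ↦ ENNReal.ofReal (m x)).map u₁ ≤ C • volume)
    {α : ℝ} (hα : 1 / 3 < α) (hα2 : α < 1 / 2) :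
    ∃ c : ℝ≥0∞, c ≠ ⊤ ∧ ∀ f g h : ℝ → ℂ, Measurable f → Integrable f → MemLp f 2 →
      Measurable g → Integrable g → MemLp g 2 → Measurable h → Integrable h → MemLp h 2 →
      ∫⁻ x, ‖𝓕 f (u₁ x)‖ₑ * ‖𝓕 g (u₂ x)‖ₑ * ‖𝓕 h (u₃ x)‖ₑ ∂τ
        ≤ c * (eLpNorm f (ENNReal.ofReal (1 - α))⁻¹ * eLpNorm g (ENNReal.ofReal (1 - 0))⁻¹ *
          eLpNorm h (ENNReal.ofReal (1 - 0))⁻¹) := by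
  -- With `β = γ = 0` the factors `𝓕 g`, `𝓕 h` are bounded, and `m^(1 - 3α)` lies in `L^{1/α}`
  -- because `3α - 1 < α`.
  obtain ⟨c₁, hc₁, h₁⟩ := exists_eLpNorm_fourier_fold_le hu₁ hm hm0 hKt hCt hK hC₁
    (by linarith : 0 < α) hα2 (by linarith : α ≤ 1 - α) le_rfl
  have hw := eLpNorm_rpow_neg_ne_top hm hm0 hKt hK (by linarith : 0 < 3 * α - 1)
    (by linarith : 3 * α - 1 < α)
  set W := eLpNorm (fun x ↦ m x ^ (-(3 * α - 1))) (ENNReal.ofReal α)⁻¹ τ with hW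
  refine ⟨τ univ ^ (1 - ((1 - α) + α + 0)) * (c₁ * W), ENNReal.mul_ne_top
    (ENNReal.rpow_ne_top_of_nonneg (by linarith) (measure_ne_top _ _)) (ENNReal.mul_ne_top hc₁ hw),
    fun f g h hfm hf hf2 hgm hg hg2 hhm hh hh2 ↦ ?_⟩
  have hF : Measurable fun x ↦ ‖𝓕 f (u₁ x)‖ :=
    ((continuous_fourier_of_integrable hf).measurable.comp hu₁).norm
  have hG : Measurable fun x ↦ ‖𝓕 g (u₂ x)‖ :=
    ((continuous_fourier_of_integrable hg).measurable.comp hu₂).norm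
  have hH : Measurable fun x ↦ ‖𝓕 h (u₃ x)‖ :=
    ((continuous_fourier_of_integrable hh).measurable.comp hu₃).norm
  have key := lintegral_enorm_mul_mul_le (τ := τ) (hF.mul (hm.pow_const (2 * α - (1 - α))))
    (hm.pow_const (-(3 * α - 1))) (hG.mul hH) (by linarith : 0 ≤ 1 - α)
    (by linarith : 0 ≤ α) le_rfl (by linarith)
  have hGH : eLpNorm (fun x ↦ ‖𝓕 g (u₂ x)‖ * ‖𝓕 h (u₃ x)‖) (ENNReal.ofReal 0)⁻¹ τ
      ≤ eLpNorm g (ENNReal.ofReal (1 - 0))⁻¹ * eLpNorm h (ENNReal.ofReal (1 - 0))⁻¹ := by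
    have e := eLpNorm_smul_le_mul_eLpNorm (p := ⊤) (q := ⊤) (r := ⊤) (μ := τ)
      hH.aestronglyMeasurable hG.aestronglyMeasurable
    have e2 := e.trans (mul_le_mul' ((eLpNorm_norm _).trans_le (eLpNorm_fourier_top_le τ u₂ hg))
      ((eLpNorm_norm _).trans_le (eLpNorm_fourier_top_le τ u₃ hh)))
    rw [ENNReal.ofReal_zero, ENNReal.inv_zero, sub_zero, ENNReal.ofReal_one, inv_one]
    exact e2
  have k2 := mul_le_mul' (mul_le_mul_left (h₁ f hfm hf hf2) W) hGH
  have k3 : ∀ D a b x y z : ℝ≥0∞, D * (a * b) * (x * y * z) = D * (a * x * b * (y * z)) := by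
    intros; ring
  rw [k3]
  refine le_trans (le_of_eq (lintegral_congr_ae ?_)) (key.trans (mul_le_mul_right k2 _))
  filter_upwards [ae_pos_of_sublevel_le hKt hK] with x hx
  simp only [Pi.mul_apply]
  rw [mul_assoc ‖𝓕 f (u₁ x)‖, ← Real.rpow_add hx,
    show 2 * α - (1 - α) + -(3 * α - 1) = 0 by ring, Real.rpow_zero, mul_one, ← mul_assoc]
  simp only [enorm_mul, enorm_norm]

/-- The trilinear estimate on a piece where only `u₁` folds: `m` stands for `|u₁'|`, while the
images of `τ` under `u₂` and `u₃` have bounded densities. The fold costs a factor `2` in the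
condition `2 α + β + γ ≤ 1` on the exponents `1/p = 1 - α`, `1/q = 1 - β`, `1/r = 1 - γ`. For
`α ≤ 1/3` the three factors are separately in suitable `L^σ(τ)`. For `α > 1/3`
only `𝓕 f (u₁) m^(3α - 1)` is under control, and the negative power of `m` is given to another
factor by means of Pitt's inequality. -/
theorem exists_lintegral_fourier_le_of_fold [IsFiniteMeasure τ] (hu₁ : Measurable u₁)
    (hu₂ : Measurable u₂) (hu₃ : Measurable u₃) (hm : Measurable m)
    (hm0 : ∀ x, 0 ≤ m x) {M : ℝ} (hM : ∀ x, m x ≤ M) (hKt : K ≠ ⊤) (hCt : C ≠ ⊤)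
    (hK : ∀ s : ℝ, 0 < s → τ {x | m x ≤ s} ≤ K * ENNReal.ofReal s)
    (hC₁ : (τ.withDensity fun x ↦ ENNReal.ofReal (m x)).map u₁ ≤ C • volume)
    (hC₂ : τ.map u₂ ≤ C • volume) (hC₃ : τ.map u₃ ≤ C • volume)
    {α β γ : ℝ} (hα : 0 ≤ α) (hα2 : α < 1 / 2) (hβ : 0 ≤ β) (hβ2 : β < 1 / 2) (hγ : 0 ≤ γ)
    (hγ2 : γ < 1 / 2) (hsum : 2 * α + β + γ ≤ 1) :
    ∃ c : ℝ≥0∞, c ≠ ⊤ ∧ ∀ f g h : ℝ → ℂ, Measurable f → Integrable f → MemLp f 2 →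
      Measurable g → Integrable g → MemLp g 2 → Measurable h → Integrable h → MemLp h 2 →
      ∫⁻ x, ‖𝓕 f (u₁ x)‖ₑ * ‖𝓕 g (u₂ x)‖ₑ * ‖𝓕 h (u₃ x)‖ₑ ∂τ
        ≤ c * (eLpNorm f (ENNReal.ofReal (1 - α))⁻¹ * eLpNorm g (ENNReal.ofReal (1 - β))⁻¹ *
          eLpNorm h (ENNReal.ofReal (1 - γ))⁻¹) := by
  rcases le_or_gt α (1 / 3) with hα3 | hα3
  · exact exists_lintegral_fourier_le_of_le_third hu₁ hu₂ hu₃ hm hm0 hKt hCt hK hC₁ hC₂ hC₃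
      hα hα3 hβ hβ2 hγ hγ2 hsum
  rcases hβ.eq_or_lt with rfl | hβ0
  swap
  · exact exists_lintegral_fourier_le_of_third_lt hu₁ hu₂ hu₃ hm hm0 hM hKt hCt hK hC₁ hC₂ hC₃
      hα3 hα2 hβ0 hβ2 hγ hγ2 hsum
  rcases hγ.eq_or_lt with rfl | hγ0
  swap
  · obtain ⟨c, hc, hle⟩ := exists_lintegral_fourier_le_of_third_lt hu₁ hu₃ hu₂ hm hm0 hM hKt hCt hK
      hC₁ hC₃ hC₂ hα3 hα2 hγ0 hγ2 hβ hβ2 (by linarith)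
    refine ⟨c, hc, fun f g h hfm hf hf2 hgm hg hg2 hhm hh hh2 ↦ ?_⟩
    have := hle f h g hfm hf hf2 hhm hh hh2 hgm hg hg2
    rw [mul_right_comm (eLpNorm f _ _)]
    exact le_trans (le_of_eq (lintegral_congr fun x ↦ mul_right_comm _ _ _)) this
  exact exists_lintegral_fourier_le_of_third_lt_of_zero hu₁ hu₂ hu₃ hm hm0 hKt hCt hK hC₁ hα3 hα2

end Trilinear

/-! ### Fold maps on the unit interval -/

section Fold

variable {u v w : ℝ → ℝ} {D : Set ℝ}

theorem hasDerivAt_of_mem_Ioo {a b t : ℝ} (hu : ∀ t ∈ Icc (0 : ℝ) 1,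
    HasDerivWithinAt u (v t) (Icc 0 1) t) (ha : a ∈ Icc (0 : ℝ) 1) (hb : b ∈ Icc (0 : ℝ) 1)
    (ht : t ∈ Ioo a b) : HasDerivAt u (v t) t :=
  (hu t ⟨ha.1.trans ht.1.le, ht.2.le.trans hb.2⟩).hasDerivAt
    (Icc_mem_nhds (ha.1.trans_lt ht.1) (ht.2.trans_le hb.2))

theorem exists_slope_eq (hu : ∀ t ∈ Icc (0 : ℝ) 1, HasDerivWithinAt u (v t) (Icc 0 1) t)
    (hD : D ⊆ Icc 0 1) (hDc : D.OrdConnected) {a b : ℝ} (ha : a ∈ D) (hb : b ∈ D) (hab : a < b) :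
    ∃ c ∈ D, u b - u a = v c * (b - a) := by
  obtain ⟨c, hc, h⟩ := exists_hasDerivAt_eq_slope u v hab
    (fun t ht ↦ ((hu t (hD (hDc.out ha hb ht))).continuousWithinAt).mono
      ((hDc.out ha hb).trans hD))
    (fun t ht ↦ hasDerivAt_of_mem_Ioo hu (hD ha) (hD hb) ht)
  refine ⟨c, hDc.out ha hb (Ioo_subset_Icc_self hc), ?_⟩
  rw [h, div_mul_cancel₀ _ (sub_ne_zero.2 hab.ne')]

theorem lintegral_abs_deriv_mul_le_of_ne_zero
    (hu : ∀ t ∈ Icc (0 : ℝ) 1, HasDerivWithinAt u (v t) (Icc 0 1) t)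
    (hD : D ⊆ Icc 0 1) (hDc : D.OrdConnected) (hv : ∀ t ∈ D, v t ≠ 0) (Φ : ℝ → ℝ≥0∞) :
    ∫⁻ t in D, ENNReal.ofReal |v t| * Φ (u t) ≤ ∫⁻ y, Φ y := by
  have hinj : InjOn u D := by
    intro a ha b hb hab
    by_contra hne
    rcases lt_or_gt_of_ne hne with h | h
    · obtain ⟨c, hc, h2⟩ := exists_slope_eq hu hD hDc ha hb h
      rw [hab, sub_self, eq_comm, mul_eq_zero] at h2
      exact h2.elim (hv c hc) (sub_ne_zero.2 h.ne')
    · obtain ⟨c, hc, h2⟩ := exists_slope_eq hu hD hDc hb ha h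
      rw [hab, sub_self, eq_comm, mul_eq_zero] at h2
      exact h2.elim (hv c hc) (sub_ne_zero.2 h.ne')
  rw [← lintegral_image_eq_lintegral_abs_deriv_mul hDc.measurableSet
    (fun t ht ↦ (hu t (hD ht)).mono hD) hinj]
  exact setLIntegral_le_lintegral _ _

theorem lintegral_abs_deriv_mul_le_of_ordConnected
    (hu : ∀ t ∈ Icc (0 : ℝ) 1, HasDerivWithinAt u (v t) (Icc 0 1) t)
    (hD : D ⊆ Icc 0 1) (hDc : D.OrdConnected) (hpos : (D ∩ {t | 0 < v t}).OrdConnected)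
    (hneg : (D ∩ {t | v t < 0}).OrdConnected) (Φ : ℝ → ℝ≥0∞) :
    ∫⁻ t in D, ENNReal.ofReal |v t| * Φ (u t) ≤ 2 * ∫⁻ y, Φ y := by
  set P := D ∩ {t | 0 < v t}
  set N := D ∩ {t | v t < 0}
  have hsub : D ⊆ P ∪ N ∪ D \ (P ∪ N) := by rw [union_sdiff_self]; exact subset_union_right
  have hZ : ∫⁻ t in D \ (P ∪ N), ENNReal.ofReal |v t| * Φ (u t) = 0 := by
    refine setLIntegral_eq_zero
      (hDc.measurableSet.diff (hpos.measurableSet.union hneg.measurableSet)) fun t ht ↦ ?_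
    obtain ⟨ht, hn⟩ := ht
    have h1 : ¬ 0 < v t := fun h ↦ hn (Or.inl ⟨ht, h⟩)
    have h2 : ¬ v t < 0 := fun h ↦ hn (Or.inr ⟨ht, h⟩)
    simp [le_antisymm (not_lt.1 h1) (not_lt.1 h2)]
  have hP := lintegral_abs_deriv_mul_le_of_ne_zero hu (inter_subset_left.trans hD) hpos
    (fun t ht ↦ (ne_of_gt ht.2)) Φ
  have hN := lintegral_abs_deriv_mul_le_of_ne_zero hu (inter_subset_left.trans hD) hneg
    (fun t ht ↦ (ne_of_lt ht.2)) Φ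
  calc _ ≤ _ := lintegral_mono_set hsub
    _ ≤ _ := lintegral_union_le _ _ _
    _ ≤ (∫⁻ y, Φ y) + (∫⁻ y, Φ y) + 0 :=
        add_le_add ((lintegral_union_le _ _ _).trans (add_le_add hP hN)) hZ.le
    _ = _ := by rw [add_zero, two_mul]

/-- Around every point of `[0, 1]` either `v = u'` or `w = u''` has no zero, so that the sets
`{u' > 0}` and `{u' < 0}` are intervals and the sublevel sets of `|u'|` have linear size. -/
theorem exists_nhdsWithin_fold
    (hv : ∀ t ∈ Icc (0 : ℝ) 1, HasDerivWithinAt v (w t) (Icc 0 1) t)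
    (hw : ContinuousOn w (Icc 0 1)) (hne : ∀ t ∈ Icc (0 : ℝ) 1, v t ≠ 0 ∨ w t ≠ 0)
    {t₀ : ℝ} (ht₀ : t₀ ∈ Icc (0 : ℝ) 1) :
    ∃ D ∈ nhdsWithin t₀ (Icc (0 : ℝ) 1), D ⊆ Icc 0 1 ∧ D.OrdConnected ∧
      (D ∩ {t | 0 < v t}).OrdConnected ∧ (D ∩ {t | v t < 0}).OrdConnected ∧
      ∃ K : ℝ≥0∞, K ≠ ⊤ ∧ ∀ s : ℝ, 0 < s →
        volume (D ∩ {t | |v t| ≤ s}) ≤ K * ENNReal.ofReal s := by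
  have hball : ∀ U ∈ nhdsWithin t₀ (Icc (0 : ℝ) 1), ∃ D ∈ nhdsWithin t₀ (Icc (0 : ℝ) 1),
      D ⊆ Icc 0 1 ∧ D.OrdConnected ∧ D ⊆ U := by
    intro U hU
    obtain ⟨ε, hε, h⟩ := Metric.mem_nhdsWithin_iff.1 hU
    refine ⟨Metric.ball t₀ ε ∩ Icc 0 1,
      Filter.inter_mem (mem_nhdsWithin_of_mem_nhds (Metric.ball_mem_nhds _ hε))
        self_mem_nhdsWithin, inter_subset_right, ?_, h⟩
    rw [Real.ball_eq_Ioo]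
    exact ordConnected_Ioo.inter ordConnected_Icc
  have hvc : ContinuousWithinAt v (Icc 0 1) t₀ := (hv t₀ ht₀).continuousWithinAt
  by_cases hv0 : v t₀ = 0
  · have hw0 : 0 < |w t₀| := abs_pos.2 ((hne t₀ ht₀).resolve_left (not_not.2 hv0))
    have hU : {t | |w t₀| / 2 < |w t|} ∩ {t | 0 < w t * w t₀} ∈
        nhdsWithin t₀ (Icc (0 : ℝ) 1) :=
      Filter.inter_mem ((hw t₀ ht₀).abs.eventually_const_lt (by linarith))
        (((hw t₀ ht₀).mul_const _).eventually_const_lt (mul_self_pos.2 (abs_pos.1 hw0)))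
    obtain ⟨D, hDn, hD, hDc, hDU⟩ := hball _ hU
    set c := |w t₀| / 2 with hc
    have hc0 : 0 < c := by positivity
    have hexp : ∀ a ∈ D, ∀ b ∈ D, c * |b - a| ≤ |v b - v a| := by
      have key : ∀ a ∈ D, ∀ b ∈ D, a < b → c * |b - a| ≤ |v b - v a| := by
        intro a ha b hb hab
        obtain ⟨t, ht, h⟩ := exists_slope_eq hv hD hDc ha hb hab
        rw [h, abs_mul]
        gcongr
        exact le_of_lt (hDU ht).1
      intro a ha b hb
      rcases lt_trichotomy a b with h | rfl | h
      · exact key a ha b hb h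
      · simp
      · rw [abs_sub_comm, abs_sub_comm (v b)]
        exact key b hb a ha h
    have hmono : ∀ a ∈ D, ∀ b ∈ D, a ≤ b → 0 ≤ (v b - v a) * w t₀ := by
      intro a ha b hb hab
      rcases hab.eq_or_lt with rfl | hab
      · simp
      · obtain ⟨t, ht, h⟩ := exists_slope_eq hv hD hDc ha hb hab
        have h2 : 0 < w t * w t₀ := (hDU ht).2
        rw [h, mul_right_comm]
        exact mul_nonneg h2.le (sub_nonneg.2 hab.le)
    have hmid : ∀ a ∈ D, ∀ b ∈ D, ∀ x ∈ Icc a b, x ∈ D ∧ v x ∈ uIcc (v a) (v b) := by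
      intro a ha b hb x hx
      have hxD := hDc.out ha hb hx
      refine ⟨hxD, ?_⟩
      have h1 := hmono a ha x hxD hx.1
      have h2 := hmono x hxD b hb hx.2
      rw [mem_uIcc]
      rcases lt_or_gt_of_ne (abs_pos.1 hw0) with h | h
      · exact Or.inr ⟨by nlinarith, by nlinarith⟩
      · exact Or.inl ⟨by nlinarith, by nlinarith⟩
    refine ⟨D, hDn, hD, hDc, ⟨fun a ha b hb x hx ↦ ?_⟩, ⟨fun a ha b hb x hx ↦ ?_⟩,
      ENNReal.ofReal (2 / c), ENNReal.ofReal_ne_top, fun s hs ↦ ?_⟩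
    · obtain ⟨h1, h2⟩ := hmid a ha.1 b hb.1 x hx
      exact ⟨h1, (lt_min ha.2 hb.2).trans_le h2.1⟩
    · obtain ⟨h1, h2⟩ := hmid a ha.1 b hb.1 x hx
      exact ⟨h1, h2.2.trans_lt (max_lt ha.2 hb.2)⟩
    · refine (Real.volume_le_diam _).trans (Metric.ediam_le fun a ha b hb ↦ ?_)
      rw [edist_dist, ← ENNReal.ofReal_mul (by positivity), Real.dist_eq]
      refine ENNReal.ofReal_le_ofReal ?_
      have h1 := hexp b hb.1 a ha.1
      have h2 : |v a - v b| ≤ s + s := (abs_sub _ _).trans (add_le_add ha.2 hb.2)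
      rw [div_mul_eq_mul_div, le_div_iff₀ hc0]
      linarith
  · have hv0' : 0 < |v t₀| := abs_pos.2 hv0
    have hU : {t | |v t₀| / 2 < |v t|} ∩ {t | 0 < v t * v t₀} ∈ nhdsWithin t₀ (Icc (0 : ℝ) 1) :=
      Filter.inter_mem (hvc.abs.eventually_const_lt (by linarith))
        ((hvc.mul_const _).eventually_const_lt (mul_self_pos.2 hv0))
    obtain ⟨D, hDn, hD, hDc, hDU⟩ := hball _ hU
    refine ⟨D, hDn, hD, hDc, ?_, ?_, ENNReal.ofReal (2 / |v t₀|), ENNReal.ofReal_ne_top,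
      fun s hs ↦ ?_⟩
    · rcases lt_or_gt_of_ne hv0 with h | h
      · convert ordConnected_empty
        refine eq_empty_of_forall_notMem fun t ht ↦ ?_
        have h1 : 0 < v t * v t₀ := (hDU ht.1).2
        have h2 : 0 < v t := ht.2
        nlinarith
      · convert hDc using 1
        refine inter_eq_left.2 fun t ht ↦ ?_
        have h1 : 0 < v t * v t₀ := (hDU ht).2
        show 0 < v t
        by_contra hcon
        nlinarith
    · rcases lt_or_gt_of_ne hv0 with h | h
      · convert hDc using 1
        refine inter_eq_left.2 fun t ht ↦ ?_
        have h1 : 0 < v t * v t₀ := (hDU ht).2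
        show v t < 0
        by_contra hcon
        nlinarith
      · convert ordConnected_empty
        refine eq_empty_of_forall_notMem fun t ht ↦ ?_
        have h1 : 0 < v t * v t₀ := (hDU ht.1).2
        have h2 : v t < 0 := ht.2
        nlinarith
    · rw [← ENNReal.ofReal_mul (by positivity)]
      by_cases hs2 : s ≤ |v t₀| / 2
      · have : D ∩ {t | |v t| ≤ s} = ∅ := by
          refine eq_empty_of_forall_notMem fun t ht ↦ ?_
          have h1 : |v t₀| / 2 < |v t| := (hDU ht.1).1
          have h2 : |v t| ≤ s := ht.2
          linarith
        simp [this]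
      · calc volume (D ∩ {t | |v t| ≤ s}) ≤ volume (Icc (0 : ℝ) 1) :=
              measure_mono (inter_subset_left.trans hD)
          _ = ENNReal.ofReal 1 := by simp
          _ ≤ _ := by
              refine ENNReal.ofReal_le_ofReal ?_
              rw [div_mul_eq_mul_div, le_div_iff₀ hv0']
              linarith

/-- A `C²` function on `[0, 1]` whose first two derivatives have no common zero is a fold map. -/
theorem exists_fold_constants (hu : ∀ t ∈ Icc (0 : ℝ) 1, HasDerivWithinAt u (v t) (Icc 0 1) t)
    (hv : ∀ t ∈ Icc (0 : ℝ) 1, HasDerivWithinAt v (w t) (Icc 0 1) t)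
    (hw : ContinuousOn w (Icc 0 1)) (hne : ∀ t ∈ Icc (0 : ℝ) 1, v t ≠ 0 ∨ w t ≠ 0) :
    (∃ C : ℝ≥0∞, C ≠ ⊤ ∧ ∀ Φ : ℝ → ℝ≥0∞,
      ∫⁻ t in Icc (0 : ℝ) 1, ENNReal.ofReal |v t| * Φ (u t) ≤ C * ∫⁻ y, Φ y) ∧
    ∃ K : ℝ≥0∞, K ≠ ⊤ ∧ ∀ s : ℝ, 0 < s →
      volume (Icc (0 : ℝ) 1 ∩ {t | |v t| ≤ s}) ≤ K * ENNReal.ofReal s := by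
  constructor
  · refine isCompact_Icc.induction_on (p := fun S ↦ ∃ C : ℝ≥0∞, C ≠ ⊤ ∧ ∀ Φ : ℝ → ℝ≥0∞,
      ∫⁻ t in S, ENNReal.ofReal |v t| * Φ (u t) ≤ C * ∫⁻ y, Φ y) ⟨0, by simp, by simp⟩ ?_ ?_ ?_
    · rintro S T hST ⟨C, hC, h⟩
      exact ⟨C, hC, fun Φ ↦ (lintegral_mono_set hST).trans (h Φ)⟩
    · rintro S T ⟨C, hC, h⟩ ⟨C', hC', h'⟩
      refine ⟨C + C', ENNReal.add_ne_top.2 ⟨hC, hC'⟩, fun Φ ↦ ?_⟩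
      rw [add_mul]
      exact (lintegral_union_le _ _ _).trans (add_le_add (h Φ) (h' Φ))
    · intro t ht
      obtain ⟨D, hDn, hD, hDc, hp, hn, -⟩ := exists_nhdsWithin_fold hv hw hne ht
      exact ⟨D, hDn, 2, by simp, lintegral_abs_deriv_mul_le_of_ordConnected hu hD hDc hp hn⟩
  · refine isCompact_Icc.induction_on (p := fun S ↦ ∃ K : ℝ≥0∞, K ≠ ⊤ ∧ ∀ s : ℝ, 0 < s →
      volume (S ∩ {t | |v t| ≤ s}) ≤ K * ENNReal.ofReal s) ⟨0, by simp, by simp⟩ ?_ ?_ ?_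
    · rintro S T hST ⟨C, hC, h⟩
      exact ⟨C, hC, fun s hs ↦ (measure_mono (inter_subset_inter_left _ hST)).trans (h s hs)⟩
    · rintro S T ⟨C, hC, h⟩ ⟨C', hC', h'⟩
      refine ⟨C + C', ENNReal.add_ne_top.2 ⟨hC, hC'⟩, fun s hs ↦ ?_⟩
      rw [add_mul, union_inter_distrib_right]
      exact (measure_union_le _ _).trans (add_le_add (h s hs) (h' s hs))
    · intro t ht
      obtain ⟨D, hDn, -, -, -, -, hK⟩ := exists_nhdsWithin_fold hv hw hne ht
      exact ⟨D, hDn, hK⟩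

/-- A map `u` on `[0, 1]` with derivative `v` that has at most fold singularities, in the
quantitative form needed here: the image of `|v| dt` under `u` has bounded density, and
`{|v| ≤ s}` has measure `O(s)`. -/
structure IsFoldMap (u v : ℝ → ℝ) : Prop where
  measurable : Measurable u
  measurable_deriv : Measurable v
  bounded_deriv : ∃ M : ℝ, ∀ t, |v t| ≤ M
  lintegral_le : ∃ C : ℝ≥0∞, C ≠ ⊤ ∧ ∀ Φ : ℝ → ℝ≥0∞,
    ∫⁻ t in Icc (0 : ℝ) 1, ENNReal.ofReal |v t| * Φ (u t) ≤ C * ∫⁻ y, Φ y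
  volume_le : ∃ K : ℝ≥0∞, K ≠ ⊤ ∧ ∀ s : ℝ, 0 < s →
    volume (Icc (0 : ℝ) 1 ∩ {t | |v t| ≤ s}) ≤ K * ENNReal.ofReal s

theorem isFoldMap_indicator
    (hu : ∀ t ∈ Icc (0 : ℝ) 1, HasDerivWithinAt u (v t) (Icc 0 1) t)
    (hv : ∀ t ∈ Icc (0 : ℝ) 1, HasDerivWithinAt v (w t) (Icc 0 1) t)
    (hw : ContinuousOn w (Icc 0 1)) (hne : ∀ t ∈ Icc (0 : ℝ) 1, v t ≠ 0 ∨ w t ≠ 0) :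
    IsFoldMap ((Icc 0 1).indicator u) ((Icc 0 1).indicator v) := by
  have huc : ContinuousOn u (Icc 0 1) := fun t ht ↦ (hu t ht).continuousWithinAt
  have hvc : ContinuousOn v (Icc 0 1) := fun t ht ↦ (hv t ht).continuousWithinAt
  have hmeas : ∀ {g : ℝ → ℝ}, ContinuousOn g (Icc 0 1) →
      Measurable ((Icc (0 : ℝ) 1).indicator g) := by
    intro g hg
    classical
    rw [← piecewise_eq_indicator]
    exact hg.measurable_piecewise continuousOn_const measurableSet_Icc
  obtain ⟨h1, h2⟩ := exists_fold_constants
    (u := (Icc 0 1).indicator u) (v := (Icc 0 1).indicator v) (w := w)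
    (fun t ht ↦ by
      rw [indicator_of_mem ht]
      exact (hu t ht).congr (fun x hx ↦ indicator_of_mem hx u) (indicator_of_mem ht u))
    (fun t ht ↦ (hv t ht).congr (fun x hx ↦ indicator_of_mem hx v) (indicator_of_mem ht v))
    hw (fun t ht ↦ by rw [indicator_of_mem ht]; exact hne t ht)
  refine ⟨hmeas huc, hmeas hvc, ?_, h1, h2⟩
  obtain ⟨M, hM⟩ := isCompact_Icc.exists_bound_of_continuousOn hvc
  refine ⟨max M 0, fun t ↦ ?_⟩
  by_cases ht : t ∈ Icc (0 : ℝ) 1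
  · rw [indicator_of_mem ht]; exact (hM t ht).trans (le_max_left _ _)
  · rw [indicator_of_notMem ht]; simp

end Fold

/-! ### The trilinear estimate on the unit interval -/

section Interval

variable {u v u₁ v₁ u₂ v₂ u₃ v₃ : ℝ → ℝ}

/-- A set of parameters `E` on which only `u₁` may fold contributes a bounded trilinear form. -/
theorem exists_setLIntegral_fourier_le (h₁ : IsFoldMap u₁ v₁) (h₂ : IsFoldMap u₂ v₂)
    (h₃ : IsFoldMap u₃ v₃) {δ : ℝ} (hδ : 0 < δ) {α β γ : ℝ} (hα : 0 ≤ α) (hα2 : α < 1 / 2)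
    (hβ : 0 ≤ β) (hβ2 : β < 1 / 2) (hγ : 0 ≤ γ) (hγ2 : γ < 1 / 2)
    (hsum : 2 * α + β + γ ≤ 1) :
    ∃ c : ℝ≥0∞, c ≠ ⊤ ∧ ∀ f g h : ℝ → ℂ, Measurable f → Integrable f → MemLp f 2 →
      Measurable g → Integrable g → MemLp g 2 → Measurable h → Integrable h → MemLp h 2 →
      ∫⁻ t in Icc 0 1 ∩ {t | δ ≤ |v₂ t| ∧ δ ≤ |v₃ t|},
          ‖𝓕 f (u₁ t)‖ₑ * ‖𝓕 g (u₂ t)‖ₑ * ‖𝓕 h (u₃ t)‖ₑ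
        ≤ c * (eLpNorm f (ENNReal.ofReal (1 - α))⁻¹ * eLpNorm g (ENNReal.ofReal (1 - β))⁻¹ *
          eLpNorm h (ENNReal.ofReal (1 - γ))⁻¹) := by
  set E : Set ℝ := Icc 0 1 ∩ {t | δ ≤ |v₂ t| ∧ δ ≤ |v₃ t|} with hE
  have hEm : MeasurableSet E := measurableSet_Icc.inter
    ((measurableSet_le measurable_const h₂.measurable_deriv.abs).inter
      (measurableSet_le measurable_const h₃.measurable_deriv.abs))
  have hEI : E ⊆ Icc 0 1 := inter_subset_left
  have : IsFiniteMeasure (volume.restrict E) :=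
    ⟨by rw [Measure.restrict_apply_univ]
        exact (measure_mono hEI).trans_lt measure_Icc_lt_top⟩
  obtain ⟨M, hM⟩ := h₁.bounded_deriv
  obtain ⟨K, hKt, hK⟩ := h₁.volume_le
  obtain ⟨C₁, hC₁t, hC₁⟩ := h₁.lintegral_le
  -- Where `|v| ≥ δ`, the weight `|v|` in the change of variables can be dropped.
  have hmap : ∀ {u v : ℝ → ℝ}, IsFoldMap u v → (∀ t ∈ E, δ ≤ |v t|) →
      ∃ C : ℝ≥0∞, C ≠ ⊤ ∧ (volume.restrict E).map u ≤ C • volume := by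
    intro u v h hv
    obtain ⟨C, hCt, hC⟩ := h.lintegral_le
    refine ⟨ENNReal.ofReal δ⁻¹ * C, ENNReal.mul_ne_top ENNReal.ofReal_ne_top hCt,
      Measure.le_iff.2 fun s hs ↦ ?_⟩
    rw [Measure.map_apply h.measurable hs, Measure.smul_apply, smul_eq_mul, mul_assoc]
    have h1 := hC (s.indicator 1)
    rw [lintegral_indicator_one hs] at h1
    refine le_trans ?_ (mul_le_mul_right h1 _)
    rw [← lintegral_indicator_one (h.measurable hs), ← lintegral_const_mul' _ _ ENNReal.ofReal_ne_top]
    refine (setLIntegral_mono' hEm fun t ht ↦ ?_).trans (lintegral_mono_set hEI)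
    rw [← mul_assoc, ← ENNReal.ofReal_mul (by positivity)]
    refine le_mul_of_one_le_left zero_le ?_
    rw [ENNReal.one_le_ofReal, ← div_eq_inv_mul, one_le_div hδ]
    exact hv t ht
  obtain ⟨C₂, hC₂t, hC₂⟩ := hmap h₂ fun t ht ↦ ht.2.1
  obtain ⟨C₃, hC₃t, hC₃⟩ := hmap h₃ fun t ht ↦ ht.2.2
  have hsmul : ∀ {C C' : ℝ≥0∞}, C ≤ C' → C • (volume : Measure ℝ) ≤ C' • volume := by
    intro C C' hCC
    refine Measure.le_iff.2 fun s _ ↦ ?_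
    rw [Measure.smul_apply, Measure.smul_apply]
    exact mul_le_mul_left hCC _
  refine exists_lintegral_fourier_le_of_fold (C := C₁ + C₂ + C₃) h₁.measurable h₂.measurable
    h₃.measurable
    h₁.measurable_deriv.abs (fun t ↦ abs_nonneg _) hM hKt
    (ENNReal.add_ne_top.2 ⟨ENNReal.add_ne_top.2 ⟨hC₁t, hC₂t⟩, hC₃t⟩) (fun s hs ↦ ?_) ?_
    (hC₂.trans (hsmul (le_add_right le_add_self)))
    (hC₃.trans (hsmul le_add_self)) hα hα2 hβ hβ2 hγ hγ2 hsum
  · rw [Measure.restrict_apply (measurableSet_le h₁.measurable_deriv.abs measurable_const),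
      inter_comm]
    exact (measure_mono (inter_subset_inter_left _ hEI)).trans (hK s hs)
  · refine le_trans ?_ (hsmul (le_add_right le_self_add))
    refine Measure.le_iff.2 fun s hs ↦ ?_
    rw [Measure.map_apply h₁.measurable hs, Measure.smul_apply, smul_eq_mul,
      withDensity_apply _ (h₁.measurable hs), ← lintegral_indicator (h₁.measurable hs)]
    have h1 := hC₁ (s.indicator 1)
    rw [lintegral_indicator_one hs] at h1
    refine le_trans ?_ ((lintegral_mono_set hEI).trans h1)
    refine lintegral_mono fun t ↦ ?_
    by_cases ht : u₁ t ∈ s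
    · rw [indicator_of_mem (show t ∈ u₁ ⁻¹' s from ht), indicator_of_mem ht]; simp
    · rw [indicator_of_notMem (show t ∉ u₁ ⁻¹' s from ht)]; exact zero_le

/-- The trilinear estimate on `[0, 1]` for three fold maps no two of which fold at the same point:
near each point at most one of the three conditions on the exponents is needed. -/
theorem exists_lintegral_Icc_fourier_le (h₁ : IsFoldMap u₁ v₁) (h₂ : IsFoldMap u₂ v₂)
    (h₃ : IsFoldMap u₃ v₃) {δ : ℝ} (hδ : 0 < δ)
    (h₁₂ : ∀ t ∈ Icc (0 : ℝ) 1, δ ≤ |v₁ t| ∨ δ ≤ |v₂ t|)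
    (h₁₃ : ∀ t ∈ Icc (0 : ℝ) 1, δ ≤ |v₁ t| ∨ δ ≤ |v₃ t|)
    (h₂₃ : ∀ t ∈ Icc (0 : ℝ) 1, δ ≤ |v₂ t| ∨ δ ≤ |v₃ t|)
    {α β γ : ℝ} (hα : 0 ≤ α) (hα2 : α < 1 / 2)
    (hβ : 0 ≤ β) (hβ2 : β < 1 / 2) (hγ : 0 ≤ γ) (hγ2 : γ < 1 / 2)
    (hsum₁ : 2 * α + β + γ ≤ 1) (hsum₂ : α + 2 * β + γ ≤ 1) (hsum₃ : α + β + 2 * γ ≤ 1) :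
    ∃ c : ℝ≥0∞, c ≠ ⊤ ∧ ∀ f g h : ℝ → ℂ, Measurable f → Integrable f → MemLp f 2 →
      Measurable g → Integrable g → MemLp g 2 → Measurable h → Integrable h → MemLp h 2 →
      ∫⁻ t in Icc (0 : ℝ) 1, ‖𝓕 f (u₁ t)‖ₑ * ‖𝓕 g (u₂ t)‖ₑ * ‖𝓕 h (u₃ t)‖ₑ
        ≤ c * (eLpNorm f (ENNReal.ofReal (1 - α))⁻¹ * eLpNorm g (ENNReal.ofReal (1 - β))⁻¹ *
          eLpNorm h (ENNReal.ofReal (1 - γ))⁻¹) := by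
  obtain ⟨c₁, hc₁, e₁⟩ := exists_setLIntegral_fourier_le h₁ h₂ h₃ hδ hα hα2 hβ hβ2 hγ hγ2 hsum₁
  obtain ⟨c₂, hc₂, e₂⟩ := exists_setLIntegral_fourier_le h₂ h₁ h₃ hδ hβ hβ2 hα hα2 hγ hγ2
    (by linarith)
  obtain ⟨c₃, hc₃, e₃⟩ := exists_setLIntegral_fourier_le h₃ h₁ h₂ hδ hγ hγ2 hα hα2 hβ hβ2
    (by linarith)
  refine ⟨c₁ + c₂ + c₃, ENNReal.add_ne_top.2 ⟨ENNReal.add_ne_top.2 ⟨hc₁, hc₂⟩, hc₃⟩,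
    fun f g h hfm hf hf2 hgm hg hg2 hhm hh hh2 ↦ ?_⟩
  have e₁ := e₁ f g h hfm hf hf2 hgm hg hg2 hhm hh hh2
  have e₂ := e₂ g f h hgm hg hg2 hfm hf hf2 hhm hh hh2
  have e₃ := e₃ h f g hhm hh hh2 hfm hf hf2 hgm hg hg2
  generalize eLpNorm f (ENNReal.ofReal (1 - α))⁻¹ = A at *
  generalize eLpNorm g (ENNReal.ofReal (1 - β))⁻¹ = B at *
  generalize eLpNorm h (ENNReal.ofReal (1 - γ))⁻¹ = D at *
  have r2 : ∀ t, ‖𝓕 g (u₂ t)‖ₑ * ‖𝓕 f (u₁ t)‖ₑ * ‖𝓕 h (u₃ t)‖ₑ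
      = ‖𝓕 f (u₁ t)‖ₑ * ‖𝓕 g (u₂ t)‖ₑ * ‖𝓕 h (u₃ t)‖ₑ := fun t ↦ by rw [mul_comm ‖𝓕 g _‖ₑ]
  have r3 : ∀ t, ‖𝓕 h (u₃ t)‖ₑ * ‖𝓕 f (u₁ t)‖ₑ * ‖𝓕 g (u₂ t)‖ₑ
      = ‖𝓕 f (u₁ t)‖ₑ * ‖𝓕 g (u₂ t)‖ₑ * ‖𝓕 h (u₃ t)‖ₑ := fun t ↦ by
    rw [mul_assoc, mul_comm]
  simp only [r2] at e₂
  simp only [r3] at e₃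
  have hcover : Icc (0 : ℝ) 1 ⊆ (Icc 0 1 ∩ {t | δ ≤ |v₂ t| ∧ δ ≤ |v₃ t|}) ∪
      (Icc 0 1 ∩ {t | δ ≤ |v₁ t| ∧ δ ≤ |v₃ t|}) ∪ (Icc 0 1 ∩ {t | δ ≤ |v₁ t| ∧ δ ≤ |v₂ t|}) := by
    intro t ht
    have a₁ := h₁₂ t ht
    have a₂ := h₁₃ t ht
    have a₃ := h₂₃ t ht
    simp only [mem_union, mem_inter_iff, mem_ofPred_eq, ht, true_and]
    tauto
  calc _ ≤ _ := lintegral_mono_set hcover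
    _ ≤ _ := lintegral_union_le _ _ _
    _ ≤ c₁ * (A * B * D) + c₂ * (B * A * D) + c₃ * (D * A * B) :=
        add_le_add ((lintegral_union_le _ _ _).trans (add_le_add e₁ e₂)) e₃
    _ = _ := by ring

end Interval

/-! ### Curves with non-vanishing curvature -/

section Curve

theorem hasDerivWithinAt_velocity {γ : ℝ → Plane} (hγ : ContDiffOn ℝ ∞ γ (Icc 0 1)) {t : ℝ}
    (ht : t ∈ Icc (0 : ℝ) 1) : HasDerivWithinAt γ (velocity γ t) (Icc 0 1) t :=
  ((hγ.differentiableOn (by simp)) t ht).hasDerivWithinAt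

theorem contDiffOn_velocity {γ : ℝ → Plane} (hγ : ContDiffOn ℝ ∞ γ (Icc 0 1)) :
    ContDiffOn ℝ ∞ (velocity γ) (Icc 0 1) :=
  hγ.derivWithin (uniqueDiffOn_Icc zero_lt_one) (by simp)

theorem hasDerivWithinAt_acceleration {γ : ℝ → Plane} (hγ : ContDiffOn ℝ ∞ γ (Icc 0 1)) {t : ℝ}
    (ht : t ∈ Icc (0 : ℝ) 1) :
    HasDerivWithinAt (velocity γ) (acceleration γ t) (Icc 0 1) t :=
  hasDerivWithinAt_velocity (contDiffOn_velocity hγ) ht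

theorem continuousOn_acceleration {γ : ℝ → Plane} (hγ : ContDiffOn ℝ ∞ γ (Icc 0 1)) :
    ContinuousOn (acceleration γ) (Icc 0 1) :=
  (contDiffOn_velocity (contDiffOn_velocity hγ)).continuousOn

/-- A linear functional that does not vanish at both the velocity and the acceleration restricts
to a fold map on the curve. -/
theorem isFoldMap_of_curve {γ : ℝ → Plane} (hγ : ContDiffOn ℝ ∞ γ (Icc 0 1)) (l : Plane →L[ℝ] ℝ)
    (hl : ∀ t ∈ Icc (0 : ℝ) 1, l (velocity γ t) ≠ 0 ∨ l (acceleration γ t) ≠ 0) :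
    IsFoldMap ((Icc 0 1).indicator fun t ↦ l (γ t))
      ((Icc 0 1).indicator fun t ↦ l (velocity γ t)) :=
  isFoldMap_indicator (w := fun t ↦ l (acceleration γ t))
    (fun _ ht ↦ l.hasFDerivAt.comp_hasDerivWithinAt _ (hasDerivWithinAt_velocity hγ ht))
    (fun _ ht ↦ l.hasFDerivAt.comp_hasDerivWithinAt _ (hasDerivWithinAt_acceleration hγ ht))
    (l.continuous.comp_continuousOn (continuousOn_acceleration hγ)) hl

theorem exists_pos_le_abs_or {g₁ g₂ : ℝ → ℝ} (h₁ : ContinuousOn g₁ (Icc 0 1))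
    (h₂ : ContinuousOn g₂ (Icc 0 1)) (h : ∀ t ∈ Icc (0 : ℝ) 1, g₁ t ≠ 0 ∨ g₂ t ≠ 0) :
    ∃ δ : ℝ, 0 < δ ∧ ∀ t ∈ Icc (0 : ℝ) 1, δ ≤ |g₁ t| ∨ δ ≤ |g₂ t| := by
  obtain ⟨t₀, ht₀, hmin⟩ := isCompact_Icc.exists_isMinOn (nonempty_Icc.2 (zero_le_one' ℝ))
    (h₁.abs.add h₂.abs)
  have hpos : 0 < |g₁ t₀| + |g₂ t₀| := by
    rcases h t₀ ht₀ with h | h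
    · exact add_pos_of_pos_of_nonneg (abs_pos.2 h) (abs_nonneg _)
    · exact add_pos_of_nonneg_of_pos (abs_nonneg _) (abs_pos.2 h)
  refine ⟨(|g₁ t₀| + |g₂ t₀|) / 2, half_pos hpos, fun t ht ↦ ?_⟩
  have hle : |g₁ t₀| + |g₂ t₀| ≤ |g₁ t| + |g₂ t| := hmin ht
  by_contra! hcon
  linarith [hcon.1, hcon.2]

/-- The arc-length measure of a curve is dominated by the image of a multiple of Lebesgue measure
under the parametrization, because the latter is Lipschitz. -/
theorem exists_lintegral_arcLength_le {γ : ℝ → Plane} (hγ : ContDiffOn ℝ ∞ γ (Icc 0 1)) :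
    ∃ L : ℝ≥0∞, L ≠ ⊤ ∧ ∀ Φ : Plane → ℝ≥0∞, Measurable Φ →
      ∫⁻ z, Φ z ∂(arcLength (γ '' Icc 0 1)) ≤ L * ∫⁻ t in Icc (0 : ℝ) 1, Φ (γ t) := by
  obtain ⟨M, hM⟩ := isCompact_Icc.exists_bound_of_continuousOn
    (contDiffOn_velocity hγ).continuousOn
  have hlip : LipschitzOnWith M.toNNReal γ (Icc 0 1) :=
    (convex_Icc 0 1).lipschitzOnWith_of_nnnorm_hasDerivWithin_le
      (fun t ht ↦ hasDerivWithinAt_velocity hγ ht)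
      (fun t ht ↦ by rw [← NNReal.coe_le_coe]; exact (hM t ht).trans (Real.le_coe_toNNReal M))
  have hmeas : AEMeasurable γ (volume.restrict (Icc 0 1)) :=
    hγ.continuousOn.aemeasurable measurableSet_Icc
  refine ⟨M.toNNReal, ENNReal.coe_ne_top, fun Φ hΦ ↦ ?_⟩
  have hle : arcLength (γ '' Icc 0 1)
      ≤ (M.toNNReal : ℝ≥0∞) • (volume.restrict (Icc 0 1)).map γ := by
    refine Measure.le_iff.2 fun B hB ↦ ?_
    rw [arcLength, Measure.restrict_apply hB, Measure.smul_apply, smul_eq_mul,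
      Measure.map_apply_of_aemeasurable hmeas hB, Measure.restrict_apply' measurableSet_Icc,
      inter_comm, ← image_inter_preimage, inter_comm]
    have h := (hlip.mono (inter_subset_right (s := γ ⁻¹' B))).hausdorffMeasure_image_le zero_le_one
    simpa [hausdorffMeasure_real] using h
  calc ∫⁻ z, Φ z ∂(arcLength (γ '' Icc 0 1))
      ≤ ∫⁻ z, Φ z ∂((M.toNNReal : ℝ≥0∞) • (volume.restrict (Icc 0 1)).map γ) :=
        lintegral_mono' hle le_rfl
    _ = _ := by
        rw [lintegral_smul_measure, smul_eq_mul, lintegral_map' hΦ.aemeasurable hmeas]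

theorem isFiniteMeasure_arcLength {Γ : Set Plane} (hΓ : IsSmoothCurvedCurve Γ) :
    IsFiniteMeasure (arcLength Γ) := by
  obtain ⟨γ, hγ, rfl, -, -⟩ := hΓ
  obtain ⟨L, hL, h⟩ := exists_lintegral_arcLength_le hγ
  refine ⟨?_⟩
  have h1 := h (fun _ ↦ 1) measurable_const
  simp only [lintegral_const, one_mul] at h1
  refine h1.trans_lt (ENNReal.mul_lt_top hL.lt_top ?_)
  simp

/-- The trilinear restriction estimate on a curve with non-vanishing curvature. The three linear
functionals `ξ`, `η`, `-(ξ + η)` are fold maps on the curve since the curvature does not vanish, and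
no two of them are critical at the same point since the velocity does not vanish. -/
theorem exists_lintegral_arcLength_fourier_le {Γ : Set Plane} (hΓ : IsSmoothCurvedCurve Γ)
    {α β κ : ℝ} (hα : 0 ≤ α) (hα2 : α < 1 / 2)
    (hβ : 0 ≤ β) (hβ2 : β < 1 / 2) (hκ : 0 ≤ κ) (hκ2 : κ < 1 / 2)
    (hsum₁ : 2 * α + β + κ ≤ 1) (hsum₂ : α + 2 * β + κ ≤ 1) (hsum₃ : α + β + 2 * κ ≤ 1) :
    ∃ c : ℝ≥0∞, c ≠ ⊤ ∧ ∀ f g h : ℝ → ℂ, Measurable f → Integrable f → MemLp f 2 →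
      Measurable g → Integrable g → MemLp g 2 → Measurable h → Integrable h → MemLp h 2 →
      ∫⁻ z, ‖𝓕 f ((2 * Real.pi)⁻¹ * z 0)‖ₑ * ‖𝓕 g ((2 * Real.pi)⁻¹ * z 1)‖ₑ *
          ‖𝓕 h (-((2 * Real.pi)⁻¹ * (z 0 + z 1)))‖ₑ ∂(arcLength Γ)
        ≤ c * (eLpNorm f (ENNReal.ofReal (1 - α))⁻¹ * eLpNorm g (ENNReal.ofReal (1 - β))⁻¹ *
          eLpNorm h (ENNReal.ofReal (1 - κ))⁻¹) := by
  obtain ⟨γ, hγ, rfl, hvel, hcurv⟩ := hΓ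
  set π' : ℝ := (2 * Real.pi)⁻¹ with hπ
  have hπ0 : π' ≠ 0 := by positivity
  set l₁ : Plane →L[ℝ] ℝ := π' • EuclideanSpace.proj 0 with hl₁
  set l₂ : Plane →L[ℝ] ℝ := π' • EuclideanSpace.proj 1 with hl₂
  set l₃ : Plane →L[ℝ] ℝ := -(l₁ + l₂) with hl₃
  have e₁ : ∀ z : Plane, l₁ z = π' * z 0 := fun z ↦ by simp [hl₁]
  have e₂ : ∀ z : Plane, l₂ z = π' * z 1 := fun z ↦ by simp [hl₂]
  have e₃ : ∀ z : Plane, l₃ z = -(π' * (z 0 + z 1)) := fun z ↦ by simp [hl₃, e₁, e₂]; ring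
  have hdet : ∀ t ∈ Icc (0 : ℝ) 1, velocity γ t 0 * acceleration γ t 1
      - velocity γ t 1 * acceleration γ t 0 ≠ 0 := fun t ht h0 ↦ hcurv t ht (by
    rw [signedCurvature, h0, zero_div])
  have hvel0 : ∀ t ∈ Icc (0 : ℝ) 1, velocity γ t 0 = 0 → velocity γ t 1 = 0 → False := by
    intro t ht h0 h1
    refine hvel t ht ?_
    ext i
    fin_cases i
    · exact h0
    · exact h1
  have f₁ := isFoldMap_of_curve hγ l₁ (by
    intro t ht
    by_contra! hcon
    simp only [e₁, mul_eq_zero, hπ0, false_or] at hcon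
    exact hdet t ht (by rw [hcon.1, hcon.2]; ring))
  have f₂ := isFoldMap_of_curve hγ l₂ (by
    intro t ht
    by_contra! hcon
    simp only [e₂, mul_eq_zero, hπ0, false_or] at hcon
    exact hdet t ht (by rw [hcon.1, hcon.2]; ring))
  have f₃ := isFoldMap_of_curve hγ l₃ (by
    intro t ht
    by_contra! hcon
    simp only [e₃, neg_eq_zero, mul_eq_zero, hπ0, false_or] at hcon
    refine hdet t ht ?_
    rw [eq_neg_of_add_eq_zero_left hcon.1, eq_neg_of_add_eq_zero_left hcon.2]; ring)
  have hcv : ∀ l : Plane →L[ℝ] ℝ, ContinuousOn (fun t ↦ l (velocity γ t)) (Icc 0 1) := fun l ↦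
    l.continuous.comp_continuousOn (contDiffOn_velocity hγ).continuousOn
  obtain ⟨δ₁, hδ₁, d₁⟩ := exists_pos_le_abs_or (hcv l₁) (hcv l₂) (by
    intro t ht
    by_contra! hcon
    simp only [e₁, e₂, mul_eq_zero, hπ0, false_or] at hcon
    exact hvel0 t ht hcon.1 hcon.2)
  obtain ⟨δ₂, hδ₂, d₂⟩ := exists_pos_le_abs_or (hcv l₁) (hcv l₃) (by
    intro t ht
    by_contra! hcon
    simp only [e₁, e₃, neg_eq_zero, mul_eq_zero, hπ0, false_or] at hcon
    exact hvel0 t ht hcon.1 (by linarith [hcon.1, hcon.2]))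
  obtain ⟨δ₃, hδ₃, d₃⟩ := exists_pos_le_abs_or (hcv l₂) (hcv l₃) (by
    intro t ht
    by_contra! hcon
    simp only [e₂, e₃, neg_eq_zero, mul_eq_zero, hπ0, false_or] at hcon
    exact hvel0 t ht (by linarith [hcon.1, hcon.2]) hcon.1)
  have hδ : 0 < min δ₁ (min δ₂ δ₃) := lt_min hδ₁ (lt_min hδ₂ hδ₃)
  have m₁ : min δ₁ (min δ₂ δ₃) ≤ δ₁ := min_le_left _ _
  have m₂ : min δ₁ (min δ₂ δ₃) ≤ δ₂ := (min_le_right _ _).trans (min_le_left _ _)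
  have m₃ : min δ₁ (min δ₂ δ₃) ≤ δ₃ := (min_le_right _ _).trans (min_le_right _ _)
  obtain ⟨c, hc, hle⟩ := exists_lintegral_Icc_fourier_le f₁ f₂ f₃ hδ
    (fun t ht ↦ by
      rw [indicator_of_mem ht, indicator_of_mem ht]; exact (d₁ t ht).imp m₁.trans m₁.trans)
    (fun t ht ↦ by
      rw [indicator_of_mem ht, indicator_of_mem ht]; exact (d₂ t ht).imp m₂.trans m₂.trans)
    (fun t ht ↦ by
      rw [indicator_of_mem ht, indicator_of_mem ht]; exact (d₃ t ht).imp m₃.trans m₃.trans)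
    hα hα2 hβ hβ2 hκ hκ2 hsum₁ hsum₂ hsum₃
  obtain ⟨L, hL, hLle⟩ := exists_lintegral_arcLength_le hγ
  refine ⟨L * c, ENNReal.mul_ne_top hL hc, fun f g h hfm hf hf2 hgm hg hg2 hhm hh hh2 ↦ ?_⟩
  have cf := continuous_fourier_of_integrable hf
  have cg := continuous_fourier_of_integrable hg
  have ch := continuous_fourier_of_integrable hh
  simp only [← e₁, ← e₂, ← e₃]
  refine (hLle (fun z ↦ ‖𝓕 f (l₁ z)‖ₑ * ‖𝓕 g (l₂ z)‖ₑ * ‖𝓕 h (l₃ z)‖ₑ)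
    (((cf.comp l₁.continuous).measurable.enorm.mul (cg.comp l₂.continuous).measurable.enorm).mul
      (ch.comp l₃.continuous).measurable.enorm)).trans ?_
  rw [mul_assoc]
  refine mul_le_mul_right (le_trans (le_of_eq ?_)
    (hle f g h hfm hf hf2 hgm hg hg2 hhm hh hh2)) _
  refine setLIntegral_congr_fun measurableSet_Icc fun t ht ↦ ?_
  simp only [indicator_of_mem ht]

end Curve

/-! ### Duality and extension to Lebesgue spaces -/

section Duality

/-- A bounded function `F` whose pairings with all `h ∈ L¹ ∩ L²` are bounded by
`N ‖h‖_{L^{1/(1-κ)}}` has norm at most `N` in the dual space `L^{1/κ}`. -/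
theorem eLpNorm_le_of_forall_integral_mul_le {F : ℝ → ℂ} (hF : Measurable F) {B : ℝ}
    (hB : ∀ x, ‖F x‖ ≤ B) {N : ℝ≥0∞} (hN : N ≠ ⊤) {κ : ℝ} (hκ : 0 ≤ κ) (hκ2 : κ < 1 / 2)
    (h : ∀ h : ℝ → ℂ, Measurable h → Integrable h → MemLp h 2 →
      ‖∫ x, F x * h x‖ₑ ≤ N * eLpNorm h (ENNReal.ofReal (1 - κ))⁻¹) :
    eLpNorm F (ENNReal.ofReal κ)⁻¹ ≤ N := by
  -- Bounded functions with bounded support are admissible test functions.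
  have htest : ∀ {g : ℝ → ℂ} {S : Set ℝ}, Measurable g → MeasurableSet S → volume S ≠ ⊤ →
      (∃ C, ∀ x, ‖g x‖ ≤ C) →
      Measurable (S.indicator g) ∧ Integrable (S.indicator g) ∧ MemLp (S.indicator g) 2 := by
    intro g S hg hS hSt ⟨C, hC⟩
    have : IsFiniteMeasure (volume.restrict S) := ⟨by simpa using hSt.lt_top⟩
    have hm : ∀ p : ℝ≥0∞, MemLp (S.indicator g) p := fun p ↦
      (memLp_indicator_iff_restrict hS).2
        (MemLp.of_bound hg.aestronglyMeasurable C (.of_forall hC))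
    exact ⟨hg.indicator hS, memLp_one_iff_integrable.1 (hm 1), hm 2⟩
  have hconj : ∀ z : ℂ, z * (starRingEnd ℂ) z = ((‖z‖ ^ 2 : ℝ) : ℂ) := fun z ↦ by
    rw [Complex.mul_conj, Complex.normSq_eq_norm_sq]
  have hB0 : 0 ≤ B := (norm_nonneg _).trans (hB 0)
  rcases hκ.eq_or_lt with rfl | hκ0
  · rw [ENNReal.ofReal_zero, ENNReal.inv_zero, eLpNorm_exponent_top]
    refine ENNReal.le_of_forall_pos_le_add fun ε hε _ ↦ ?_
    refine eLpNormEssSup_le_of_ae_enorm_bound ?_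
    have hnull : ∀ n : ℕ, volume ({x | N + ε < ‖F x‖ₑ} ∩ Icc (-n : ℝ) n) = 0 := by
      intro n
      set S := {x | N + ε < ‖F x‖ₑ} ∩ Icc (-n : ℝ) n with hS
      have hSm : MeasurableSet S :=
        (measurableSet_lt measurable_const hF.enorm).inter measurableSet_Icc
      have hSt : volume S ≠ ⊤ :=
        ne_top_of_le_ne_top measure_Icc_lt_top.ne (measure_mono inter_subset_right)
      -- The test function is the conjugate phase of `F` on the set where `|F|` is too large.
      set g : ℝ → ℂ := fun x ↦ (starRingEnd ℂ) (F x) * ((‖F x‖⁻¹ : ℝ) : ℂ) with hg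
      have hgm : Measurable g :=
        (Complex.continuous_conj.measurable.comp hF).mul
          (Complex.measurable_ofReal.comp hF.norm.inv)
      have hg1 : ∀ x, ‖g x‖ ≤ 1 := by
        intro x
        simp only [hg, norm_mul, RCLike.norm_conj, Complex.norm_real, norm_inv, norm_norm]
        exact mul_inv_le_one
      obtain ⟨t1, t2, t3⟩ := htest hgm hSm hSt ⟨1, hg1⟩
      have key := h _ t1 t2 t3
      have hint : ∫ x, F x * S.indicator g x = ((∫ x in S, ‖F x‖ : ℝ) : ℂ) := by
        rw [← integral_complex_ofReal, ← integral_indicator hSm]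
        refine integral_congr_ae (.of_forall fun x ↦ ?_)
        by_cases hx : x ∈ S
        · simp only [indicator_of_mem hx, hg]
          rw [← mul_assoc, hconj, ← Complex.ofReal_mul]
          congr 1
          rcases eq_or_ne ‖F x‖ 0 with h0 | h0
          · simp [h0]
          · field_simp
        · simp [indicator_of_notMem hx]
      have hnorm : eLpNorm (S.indicator g) (ENNReal.ofReal (1 - 0))⁻¹ ≤ volume S := by
        rw [sub_zero, ENNReal.ofReal_one, inv_one, eLpNorm_one_eq_lintegral_enorm,
          ← lintegral_indicator_one hSm]
        refine lintegral_mono fun x ↦ ?_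
        by_cases hx : x ∈ S
        · rw [indicator_of_mem hx, indicator_of_mem hx, Pi.one_apply, ← ofReal_norm, ENNReal.ofReal_le_one]
          exact hg1 x
        · simp [indicator_of_notMem hx]
      have hFS : IntegrableOn F S := by
        have : IsFiniteMeasure (volume.restrict S) := ⟨by simpa using hSt.lt_top⟩
        exact (Integrable.of_bound hF.aestronglyMeasurable B (.of_forall hB))
      have hlow : (N + ε) * volume S ≤ N * volume S := by
        calc (N + ε) * volume S = ∫⁻ _ in S, (N + ε) := by rw [setLIntegral_const]
          _ ≤ ∫⁻ x in S, ‖F x‖ₑ := setLIntegral_mono' hSm fun x hx ↦ le_of_lt hx.1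
          _ = ‖∫ x, F x * S.indicator g x‖ₑ := by
              rw [hint, ← ofReal_integral_norm_eq_lintegral_enorm hFS, ← ofReal_norm,
                Complex.norm_real, Real.norm_of_nonneg (integral_nonneg fun _ ↦ norm_nonneg _)]
          _ ≤ N * volume S := key.trans (mul_le_mul_right hnorm _)
      by_contra hne
      have := (ENNReal.mul_le_mul_iff_left hne hSt).1 hlow
      exact absurd this (not_le.2 (ENNReal.lt_add_right hN (by simpa using hε.ne')))
    have hU : {x | N + ε < ‖F x‖ₑ} = ⋃ n : ℕ, {x | N + ε < ‖F x‖ₑ} ∩ Icc (-n : ℝ) n := by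
      rw [← inter_iUnion]
      refine (inter_eq_left.2 fun x _ ↦ ?_).symm
      obtain ⟨n, hn⟩ := exists_nat_ge |x|
      exact mem_iUnion.2 ⟨n, abs_le.1 hn⟩
    rw [ae_iff]
    simp only [not_le]
    rw [hU]
    exact measure_iUnion_null hnull
  · rw [eLpNorm_inv_ofReal hκ0]
    set s := κ⁻¹ with hs
    have hs2 : 2 < s := by rw [hs, lt_inv_comm₀ two_pos hκ0]; linarith
    have h1κ : 0 < 1 - κ := by linarith
    -- The extremal function for Hölder's inequality, to be cut to bounded intervals.
    set g : ℝ → ℂ := fun x ↦ (starRingEnd ℂ) (F x) * ((‖F x‖ ^ (s - 2) : ℝ) : ℂ) with hg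
    have hgm : Measurable g := (Complex.continuous_conj.measurable.comp hF).mul
      (Complex.measurable_ofReal.comp (hF.norm.pow_const _))
    have hgn : ∀ x, ‖g x‖ = ‖F x‖ ^ (s - 1) := by
      intro x
      rw [hg]
      simp only [norm_mul, RCLike.norm_conj, Complex.norm_real]
      rw [Real.norm_of_nonneg (by positivity)]
      nth_rewrite 1 [← Real.rpow_one ‖F x‖]
      rw [← Real.rpow_add_of_nonneg (norm_nonneg _) zero_le_one (by linarith)]
      ring_nf
    have hgB : ∀ x, ‖g x‖ ≤ B ^ (s - 1) := fun x ↦ by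
      rw [hgn]; exact Real.rpow_le_rpow (norm_nonneg _) (hB x) (by linarith)
    have hloc : ∀ n : ℕ, (∫⁻ x in Icc (-n : ℝ) n, ENNReal.ofReal (‖F x‖ ^ s)) ^ κ ≤ N := by
      intro n
      set S := Icc (-n : ℝ) n with hS
      have hSm : MeasurableSet S := measurableSet_Icc
      have hSt : volume S ≠ ⊤ := measure_Icc_lt_top.ne
      have hfin : IsFiniteMeasure (volume.restrict S) := ⟨by simpa using hSt.lt_top⟩
      obtain ⟨t1, t2, t3⟩ := htest hgm hSm hSt ⟨_, hgB⟩
      have key := h _ t1 t2 t3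
      set Y := ∫⁻ x in S, ENNReal.ofReal (‖F x‖ ^ s) with hY
      have hIs : IntegrableOn (fun x ↦ ‖F x‖ ^ s) S :=
        Integrable.of_bound (hF.norm.pow_const s).aestronglyMeasurable (B ^ s)
          (.of_forall fun x ↦ by
            rw [Real.norm_of_nonneg (by positivity)]
            exact Real.rpow_le_rpow (norm_nonneg _) (hB x) (by linarith))
      have hYe : Y = ENNReal.ofReal (∫ x in S, ‖F x‖ ^ s) :=
        (ofReal_integral_eq_lintegral_ofReal hIs (.of_forall fun x ↦ by positivity)).symm
      have hYt : Y ≠ ⊤ := by rw [hYe]; exact ENNReal.ofReal_ne_top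
      have hint : ∫ x, F x * S.indicator g x = ((∫ x in S, ‖F x‖ ^ s : ℝ) : ℂ) := by
        rw [← integral_complex_ofReal, ← integral_indicator hSm]
        refine integral_congr_ae (.of_forall fun x ↦ ?_)
        by_cases hx : x ∈ S
        · simp only [indicator_of_mem hx, hg]
          rw [← mul_assoc, hconj, ← Complex.ofReal_mul, ← Real.rpow_natCast,
            ← Real.rpow_add_of_nonneg (norm_nonneg _) (by norm_num) (by linarith)]
          norm_num
        · simp [indicator_of_notMem hx]
      have hnorm : eLpNorm (S.indicator g) (ENNReal.ofReal (1 - κ))⁻¹ = Y ^ (1 - κ) := by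
        rw [eLpNorm_inv_ofReal h1κ, hY, ← lintegral_indicator hSm]
        congr 1
        refine lintegral_congr fun x ↦ ?_
        by_cases hx : x ∈ S
        · rw [indicator_of_mem hx, indicator_of_mem hx, hgn, ← Real.rpow_mul (norm_nonneg _)]
          congr 2
          rw [hs]; field_simp
        · rw [indicator_of_notMem hx, indicator_of_notMem hx, norm_zero,
            Real.zero_rpow (inv_ne_zero h1κ.ne'), ENNReal.ofReal_zero]
      have hYle : Y ≤ N * Y ^ (1 - κ) := by
        rw [← hnorm]
        refine le_trans (le_of_eq ?_) key
        rw [hint, ← ofReal_norm, Complex.norm_real,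
          Real.norm_of_nonneg (integral_nonneg fun _ ↦ by positivity), hYe]
      rcases eq_or_ne Y 0 with h0 | h0
      · rw [h0, ENNReal.zero_rpow_of_pos hκ0]; exact zero_le
      · have hsplit : Y = Y ^ κ * Y ^ (1 - κ) := by
          rw [← ENNReal.rpow_add _ _ h0 hYt, add_sub_cancel, ENNReal.rpow_one]
        rw [hsplit] at hYle
        have hp0 : Y ^ (1 - κ) ≠ 0 := by
          rw [Ne, ENNReal.rpow_eq_zero_iff_of_pos h1κ]; exact h0
        refine (ENNReal.mul_le_mul_iff_left hp0 (ENNReal.rpow_ne_top_of_nonneg h1κ.le hYt)).1 ?_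
        convert hYle using 2
        rw [← hsplit]
    have hlim := (aecover_Icc (μ := (volume : Measure ℝ))
      (Filter.tendsto_neg_atTop_atBot.comp (tendsto_natCast_atTop_atTop (R := ℝ)))
      (tendsto_natCast_atTop_atTop (R := ℝ))).lintegral_tendsto_of_countably_generated
      (f := fun x ↦ ENNReal.ofReal (‖F x‖ ^ s)) (by fun_prop)
    exact le_of_tendsto' (((ENNReal.continuous_rpow_const (y := κ)).tendsto _).comp hlim) hloc

end Duality

section Extension

variable {p q s : ℝ≥0∞} [Fact (1 ≤ p)] [Fact (1 ≤ q)] [Fact (1 ≤ s)]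

/-- A bilinear operator on Schwartz functions that satisfies the norm inequality extends to a
continuous bilinear map, by density of the Schwartz functions in both variables. -/
theorem isBoundedBilinear_of_eLpNorm_le {T : 𝓢(ℝ, ℂ) → 𝓢(ℝ, ℂ) → ℝ → ℂ} (hp : p ≠ ⊤) (hq : q ≠ ⊤)
    (hT : ∀ f g, AEStronglyMeasurable (T f g) volume)
    (hadd₁ : ∀ f f' g, T (f + f') g = T f g + T f' g)
    (hadd₂ : ∀ f g g', T f (g + g') = T f g + T f g')
    (hsmul₁ : ∀ (c : ℂ) f g, T (c • f) g = c • T f g)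
    (hsmul₂ : ∀ (c : ℂ) f g, T f (c • g) = c • T f g)
    {C : ℝ≥0∞} (hC : C ≠ ⊤)
    (hbound : ∀ f g : 𝓢(ℝ, ℂ), eLpNorm (T f g) s ≤ C * (eLpNorm f p * eLpNorm g q)) :
    IsBoundedBilinear T p q s := by
  have hmem : ∀ f g : 𝓢(ℝ, ℂ), MemLp (T f g) s := fun f g ↦ ⟨hT f g, (hbound f g).trans_lt
    (ENNReal.mul_lt_top hC.lt_top (ENNReal.mul_lt_top (f.memLp p volume).eLpNorm_lt_top
      (g.memLp q volume).eLpNorm_lt_top))⟩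
  set ep := (SchwartzMap.toLpCLM ℂ ℂ p (volume : Measure ℝ)).toLinearMap with hep
  set eq := (SchwartzMap.toLpCLM ℂ ℂ q (volume : Measure ℝ)).toLinearMap with heq
  have hdp : DenseRange ep := SchwartzMap.denseRange_toLpCLM hp
  have hdq : DenseRange eq := SchwartzMap.denseRange_toLpCLM hq
  let B₀ : 𝓢(ℝ, ℂ) → 𝓢(ℝ, ℂ) →ₗ[ℂ] Lp ℂ s (volume : Measure ℝ) := fun f ↦
    { toFun := fun g ↦ (hmem f g).toLp
      map_add' := fun g g' ↦ by
        rw [← MemLp.toLp_add]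
        exact MemLp.toLp_congr _ _ (by rw [hadd₂])
      map_smul' := fun c g ↦ by
        rw [RingHom.id_apply, ← MemLp.toLp_const_smul]
        exact MemLp.toLp_congr _ _ (by rw [hsmul₂]) }
  have hB₀ : ∀ f g, B₀ f g = (hmem f g).toLp := fun f g ↦ rfl
  have hn₀ : ∀ f g, ‖B₀ f g‖ ≤ C.toReal * ‖ep f‖ * ‖eq g‖ := by
    intro f g
    have h1 : ‖ep f‖ = (eLpNorm f p).toReal := SchwartzMap.norm_toLp
    have h2 : ‖eq g‖ = (eLpNorm g q).toReal := SchwartzMap.norm_toLp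
    rw [hB₀, Lp.norm_toLp, h1, h2, mul_assoc, ← ENNReal.toReal_mul, ← ENNReal.toReal_mul]
    exact ENNReal.toReal_mono (ENNReal.mul_ne_top hC (ENNReal.mul_ne_top
      (f.memLp p volume).eLpNorm_ne_top (g.memLp q volume).eLpNorm_ne_top)) (hbound f g)
  have hB₁ : ∀ f g, (B₀ f).extendOfNorm eq (eq g) = B₀ f g := fun f g ↦
    LinearMap.extendOfNorm_eq hdq ⟨_, hn₀ f⟩ g
  let B₁ : 𝓢(ℝ, ℂ) →ₗ[ℂ] Lp ℂ q (volume : Measure ℝ) →L[ℂ] Lp ℂ s (volume : Measure ℝ) :=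
    { toFun := fun f ↦ (B₀ f).extendOfNorm eq
      map_add' := fun f f' ↦ by
        refine ContinuousLinearMap.coeFn_injective (hdq.equalizer
          (ContinuousLinearMap.continuous _) (ContinuousLinearMap.continuous _) ?_)
        funext g
        simp only [Function.comp_apply, add_apply, hB₁, hB₀]
        rw [← MemLp.toLp_add]
        exact MemLp.toLp_congr _ _ (by rw [hadd₁])
      map_smul' := fun c f ↦ by
        refine ContinuousLinearMap.coeFn_injective (hdq.equalizer
          (ContinuousLinearMap.continuous _) (ContinuousLinearMap.continuous _) ?_)
        funext g
        simp only [Function.comp_apply, smul_apply, hB₁, hB₀,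
          RingHom.id_apply]
        rw [← MemLp.toLp_const_smul]
        exact MemLp.toLp_congr _ _ (by rw [hsmul₁]) }
  have hn₁ : ∀ f, ‖B₁ f‖ ≤ C.toReal * ‖ep f‖ := fun f ↦
    LinearMap.opNorm_extendOfNorm_le hdq (by positivity) (hn₀ f)
  refine ⟨B₁.extendOfNorm ep, fun f g ↦ ?_⟩
  have h1 : B₁.extendOfNorm ep (ep f) = B₁ f := LinearMap.extendOfNorm_eq hdp ⟨_, hn₁⟩ f
  have h2 : B₁.extendOfNorm ep (f.toLp p volume) (g.toLp q volume) = (hmem f g).toLp := by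
    have : B₁.extendOfNorm ep (f.toLp p volume) = B₁ f := h1
    rw [this]
    exact hB₁ f g
  rw [h2]
  exact (hmem f g).coeFn_toLp

end Extension

/-! ### The bilinear restriction-extension operator -/

section Operator

variable {Γ : Set Plane} {a : Plane → ℂ}

theorem fourierHat_eq (f : ℝ → ℂ) (ξ : ℝ) :
    fourierHat f ξ = ((Real.sqrt (2 * Real.pi))⁻¹ : ℝ) * 𝓕 f ((2 * Real.pi)⁻¹ * ξ) := by
  rw [fourierHat, Real.fourier_real_eq]
  congr 1
  refine integral_congr_ae (.of_forall fun x ↦ ?_)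
  simp only [Circle.smul_def, Real.fourierChar_apply, smul_eq_mul]
  congr 2
  push_cast
  have : (Real.pi : ℂ) ≠ 0 := by exact_mod_cast Real.pi_ne_zero
  field_simp

theorem continuous_fourierHat {f : ℝ → ℂ} (hf : Integrable f) : Continuous (fourierHat f) := by
  rw [funext (fourierHat_eq f)]
  exact continuous_const.mul ((continuous_fourier_of_integrable hf).comp (by fun_prop))

theorem norm_fourierHat_le (f : ℝ → ℂ) (ξ : ℝ) :
    ‖fourierHat f ξ‖ ≤ (Real.sqrt (2 * Real.pi))⁻¹ * ∫ x, ‖f x‖ := by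
  rw [fourierHat_eq, norm_mul, Complex.norm_real, Real.norm_of_nonneg (by positivity)]
  exact mul_le_mul_of_nonneg_left (norm_fourier_le_integral_norm f _) (by positivity)

theorem fourierHat_add (f g : 𝓢(ℝ, ℂ)) (ξ : ℝ) :
    fourierHat (f + g : 𝓢(ℝ, ℂ)) ξ = fourierHat f ξ + fourierHat g ξ := by
  rw [fourierHat_eq, fourierHat_eq, fourierHat_eq, ← SchwartzMap.fourier_coe,
    ← SchwartzMap.fourier_coe, ← SchwartzMap.fourier_coe, FourierTransform.fourier_add,
    add_apply, mul_add]

theorem fourierHat_smul (c : ℂ) (f : 𝓢(ℝ, ℂ)) (ξ : ℝ) :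
    fourierHat (c • f : 𝓢(ℝ, ℂ)) ξ = c * fourierHat f ξ := by
  rw [fourierHat_eq, fourierHat_eq, ← SchwartzMap.fourier_coe,
    ← SchwartzMap.fourier_coe, FourierTransform.fourier_smul,
    smul_apply, smul_eq_mul, mul_left_comm]

theorem norm_exp_I_mul (x y z : ℝ) : ‖Complex.exp (Complex.I * x * (y + z))‖ = 1 := by
  rw [show Complex.I * (x : ℂ) * ((y : ℂ) + z) = ((x * (y + z) : ℝ) : ℂ) * Complex.I by
    push_cast; ring]
  exact Complex.norm_exp_ofReal_mul_I _

theorem integrable_amplitude [IsFiniteMeasure (arcLength Γ)] (ha : Continuous a) {A : ℝ}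
    (hA : ∀ z, ‖a z‖ ≤ A) (f g : 𝓢(ℝ, ℂ)) :
    Integrable (fun z : Plane ↦ fourierHat f (z 0) * fourierHat g (z 1) * a z) (arcLength Γ) := by
  have cf := continuous_fourierHat f.integrable
  have cg := continuous_fourierHat g.integrable
  refine Integrable.of_bound (by fun_prop : Continuous _).aestronglyMeasurable
    (((Real.sqrt (2 * Real.pi))⁻¹ * ∫ x, ‖f x‖) * ((Real.sqrt (2 * Real.pi))⁻¹ * ∫ x, ‖g x‖) * A)
    (.of_forall fun z ↦ ?_)
  rw [norm_mul, norm_mul]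
  have h1 := norm_fourierHat_le f (z 0)
  have h2 := norm_fourierHat_le g (z 1)
  have h3 := hA z
  gcongr

theorem integrable_curveMultiplier [IsFiniteMeasure (arcLength Γ)] (ha : Continuous a) {A : ℝ}
    (hA : ∀ z, ‖a z‖ ≤ A) (f g : 𝓢(ℝ, ℂ)) (x : ℝ) :
    Integrable (fun z : Plane ↦ Complex.exp (Complex.I * x * (z 0 + z 1)) * fourierHat f (z 0) *
      fourierHat g (z 1) * a z) (arcLength Γ) := by
  have h := (integrable_amplitude (Γ := Γ) ha hA f g).bdd_mul (c := 1)
    (f := fun z : Plane ↦ Complex.exp (Complex.I * x * (z 0 + z 1)))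
    (by fun_prop : Continuous _).aestronglyMeasurable
    (.of_forall fun z ↦ (norm_exp_I_mul x (z 0) (z 1)).le)
  simpa only [mul_assoc] using h

theorem norm_curveMultiplier_le (Γ : Set Plane) (a : Plane → ℂ) (f g : 𝓢(ℝ, ℂ)) (x : ℝ) :
    ‖curveMultiplier Γ a f g x‖
      ≤ ∫ z, ‖fourierHat f (z 0) * fourierHat g (z 1) * a z‖ ∂(arcLength Γ) := by
  refine (norm_integral_le_integral_norm _).trans (le_of_eq ?_)
  refine integral_congr_ae (.of_forall fun z ↦ ?_)
  simp only [norm_mul, norm_exp_I_mul, one_mul]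

theorem continuous_curveMultiplier [IsFiniteMeasure (arcLength Γ)] (ha : Continuous a) {A : ℝ}
    (hA : ∀ z, ‖a z‖ ≤ A) (f g : 𝓢(ℝ, ℂ)) : Continuous (curveMultiplier Γ a f g) := by
  refine continuous_of_dominated
    (bound := fun z ↦ ‖fourierHat f (z 0) * fourierHat g (z 1) * a z‖)
    (fun x ↦ (integrable_curveMultiplier ha hA f g x).aestronglyMeasurable)
    (fun x ↦ .of_forall fun z ↦ ?_) (integrable_amplitude ha hA f g).norm
    (.of_forall fun z ↦ by fun_prop)
  simp only [norm_mul, norm_exp_I_mul, one_mul, le_refl]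

/-- Pairing the operator with `h` gives the trilinear form on the curve, by Fubini's theorem. -/
theorem integral_curveMultiplier_mul [IsFiniteMeasure (arcLength Γ)] (ha : Continuous a) {A : ℝ}
    (hA : ∀ z, ‖a z‖ ≤ A) (f g : 𝓢(ℝ, ℂ)) {h : ℝ → ℂ} (hh : Integrable h) :
    ∫ x, curveMultiplier Γ a f g x * h x
      = ∫ z, fourierHat f (z 0) * fourierHat g (z 1) * a z *
          𝓕 h (-((2 * Real.pi)⁻¹ * (z 0 + z 1))) ∂(arcLength Γ) := by
  have hprod : Integrable (Function.uncurry fun (x : ℝ) (z : Plane) ↦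
      Complex.exp (Complex.I * x * (z 0 + z 1)) *
        (h x * (fourierHat f (z 0) * fourierHat g (z 1) * a z)))
      ((volume : Measure ℝ).prod (arcLength Γ)) := by
    refine (hh.mul_prod (integrable_amplitude (Γ := Γ) ha hA f g)).bdd_mul (c := 1)
      (f := fun w : ℝ × Plane ↦ Complex.exp (Complex.I * w.1 * (w.2 0 + w.2 1)))
      (by fun_prop : Continuous _).aestronglyMeasurable
      (.of_forall fun w ↦ (norm_exp_I_mul w.1 (w.2 0) (w.2 1)).le)
  calc ∫ x, curveMultiplier Γ a f g x * h x
      = ∫ x : ℝ, ∫ z : Plane, Complex.exp (Complex.I * x * (z 0 + z 1)) *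
          (h x * (fourierHat f (z 0) * fourierHat g (z 1) * a z)) ∂(arcLength Γ) := by
        refine integral_congr_ae (.of_forall fun x ↦ ?_)
        simp only [curveMultiplier]
        rw [← integral_mul_const]
        refine integral_congr_ae (.of_forall fun z ↦ ?_)
        simp only []
        ring
    _ = ∫ z : Plane, (∫ x : ℝ, Complex.exp (Complex.I * x * (z 0 + z 1)) *
          (h x * (fourierHat f (z 0) * fourierHat g (z 1) * a z))) ∂(arcLength Γ) :=
        integral_integral_swap hprod
    _ = _ := by
        refine integral_congr_ae (.of_forall fun z ↦ ?_)
        simp only []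
        rw [Real.fourier_real_eq, ← integral_const_mul]
        refine integral_congr_ae (.of_forall fun x ↦ ?_)
        simp only [Circle.smul_def, Real.fourierChar_apply, smul_eq_mul]
        rw [mul_left_comm _ (Complex.exp _), mul_comm _ (h x)]
        congr 2
        push_cast
        have : (Real.pi : ℂ) ≠ 0 := by exact_mod_cast Real.pi_ne_zero
        field_simp

/-- The restriction-extension operator with a bounded continuous amplitude satisfies the norm
inequality for exponents `1/p = 1 - α`, `1/q = 1 - β`, `1/r' = κ`. -/
theorem exists_eLpNorm_curveMultiplier_le (hΓ : IsSmoothCurvedCurve Γ) (ha : Continuous a) {A : ℝ}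
    (hA : ∀ z, ‖a z‖ ≤ A) {α β κ : ℝ} (hα : 0 ≤ α) (hα2 : α < 1 / 2)
    (hβ : 0 ≤ β) (hβ2 : β < 1 / 2) (hκ : 0 ≤ κ) (hκ2 : κ < 1 / 2)
    (hsum₁ : 2 * α + β + κ ≤ 1) (hsum₂ : α + 2 * β + κ ≤ 1) (hsum₃ : α + β + 2 * κ ≤ 1) :
    ∃ c : ℝ≥0∞, c ≠ ⊤ ∧ ∀ f g : 𝓢(ℝ, ℂ),
      eLpNorm (curveMultiplier Γ a f g) (ENNReal.ofReal κ)⁻¹ ≤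
        c * (eLpNorm f (ENNReal.ofReal (1 - α))⁻¹ * eLpNorm g (ENNReal.ofReal (1 - β))⁻¹) := by
  have := isFiniteMeasure_arcLength hΓ
  obtain ⟨c, hc, hle⟩ := exists_lintegral_arcLength_fourier_le hΓ hα hα2 hβ hβ2 hκ hκ2
    hsum₁ hsum₂ hsum₃
  set π' : ℝ≥0∞ := ‖(((Real.sqrt (2 * Real.pi))⁻¹ : ℝ) : ℂ)‖ₑ with hπ
  set D : ℝ≥0∞ := π' * π' * ENNReal.ofReal A with hD
  have hDt : D ≠ ⊤ := by
    rw [hD, hπ]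
    exact ENNReal.mul_ne_top (ENNReal.mul_ne_top enorm_ne_top enorm_ne_top) ENNReal.ofReal_ne_top
  refine ⟨D * c, ENNReal.mul_ne_top hDt hc, fun f g ↦ ?_⟩
  have hbdd : ∀ (f : 𝓢(ℝ, ℂ)) {δ : ℝ}, δ < 1 / 2 →
      eLpNorm f (ENNReal.ofReal (1 - δ))⁻¹ ≠ ⊤ := fun f δ _ ↦
    (f.memLp _ volume).eLpNorm_ne_top
  refine eLpNorm_le_of_forall_integral_mul_le (continuous_curveMultiplier ha hA f g).measurable
    (norm_curveMultiplier_le Γ a f g)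
    (ENNReal.mul_ne_top (ENNReal.mul_ne_top hDt hc)
      (ENNReal.mul_ne_top (hbdd f hα2) (hbdd g hβ2))) hκ hκ2 fun h hhm hh hh2 ↦ ?_
  have key := hle f g h f.continuous.measurable f.integrable (f.memLp 2 volume)
    g.continuous.measurable g.integrable (g.memLp 2 volume) hhm hh hh2
  rw [integral_curveMultiplier_mul ha hA f g hh]
  refine (enorm_integral_le_lintegral_enorm _).trans ?_
  rw [mul_assoc D, mul_assoc D, mul_assoc c]
  refine le_trans ?_ (mul_le_mul_right key D)
  rw [← lintegral_const_mul' _ _ hDt]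
  refine lintegral_mono fun z ↦ ?_
  rw [fourierHat_eq, fourierHat_eq, enorm_mul, enorm_mul, enorm_mul, enorm_mul, enorm_mul, ← hπ, hD]
  have haz : ‖a z‖ₑ ≤ ENNReal.ofReal A := by
    rw [← ofReal_norm]; exact ENNReal.ofReal_le_ofReal (hA z)
  generalize ‖𝓕 (f : ℝ → ℂ) _‖ₑ = x
  generalize ‖𝓕 (g : ℝ → ℂ) _‖ₑ = y
  generalize ‖𝓕 h _‖ₑ = w
  calc π' * x * (π' * y) * ‖a z‖ₑ * w ≤ π' * x * (π' * y) * ENNReal.ofReal A * w := by gcongr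
    _ = _ := by ring

/-- The linear inequalities that bound the region of exponents. -/
theorem exponentRegion_subset : exponentRegion ⊆
    {x | x 0 ≤ 1 ∧ x 1 ≤ 1 ∧ x 2 ≤ 1 ∧ 3 ≤ 2 * x 0 + x 1 + x 2 ∧ 3 ≤ x 0 + 2 * x 1 + x 2 ∧
      3 ≤ x 0 + x 1 + 2 * x 2} := by
  refine convexHull_min ?_ ?_
  · rintro _ ⟨v, hv, rfl⟩
    simp only [vertexExponents, mem_insert_iff, mem_singleton_iff] at hv
    rcases hv with rfl | rfl | rfl | rfl | rfl | rfl | rfl <;> simp <;> norm_num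
  · intro x hx y hy s t hs ht hst
    simp only [mem_ofPred_eq, Pi.add_apply, Pi.smul_apply, smul_eq_mul] at hx hy ⊢
    obtain ⟨a1, a2, a3, a4, a5, a6⟩ := hx
    obtain ⟨b1, b2, b3, b4, b5, b6⟩ := hy
    have ht' : t = 1 - s := by linarith
    subst ht'
    refine ⟨?_, ?_, ?_, ?_, ?_, ?_⟩ <;> nlinarith

theorem isBoundedBilinear_curveMultiplier (hΓ : IsSmoothCurvedCurve Γ) (ha : Continuous a) {A : ℝ}
    (hA : ∀ z, ‖a z‖ ≤ A) {p q r r' : ℝ≥0∞} [Fact (1 ≤ p)] [Fact (1 ≤ q)] [Fact (1 ≤ r')]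
    (hp : p ∈ Icc 1 2) (hq : q ∈ Icc 1 2) (hr : r ∈ Icc 1 2) (hrr' : r⁻¹ + r'⁻¹ = 1)
    (hmem : ![p.toReal⁻¹, q.toReal⁻¹, r.toReal⁻¹] ∈ exponentRegion)
    (h₁ : (p, q, r) ≠ (1, 1, 2)) (h₂ : (p, q, r) ≠ (1, 2, 1)) (h₃ : (p, q, r) ≠ (2, 1, 1)) :
    IsBoundedBilinear (curveMultiplier Γ a) p q r' := by
  have := isFiniteMeasure_arcLength hΓ
  have hpt : p ≠ ⊤ := ne_top_of_le_ne_top (by simp) hp.2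
  have hqt : q ≠ ⊤ := ne_top_of_le_ne_top (by simp) hq.2
  have hrt : r ≠ ⊤ := ne_top_of_le_ne_top (by simp) hr.2
  have hinv : ∀ {p : ℝ≥0∞}, p ∈ Icc 1 2 → ENNReal.ofReal p.toReal⁻¹ = p⁻¹ := by
    intro p hp
    rw [← ENNReal.toReal_inv, ENNReal.ofReal_toReal]
    exact ENNReal.inv_ne_top.2 (one_pos.trans_le hp.1).ne'
  have heq_one : ∀ {x : ℝ≥0∞}, x.toReal⁻¹ = 1 → x = 1 := fun h ↦
    (ENNReal.toReal_eq_one_iff _).1 (inv_eq_one.1 h)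
  have heq_two : ∀ {x : ℝ≥0∞}, x ≠ ⊤ → x.toReal⁻¹ = 1 / 2 → x = 2 := fun hx h ↦
    (ENNReal.toReal_eq_toReal_iff' hx (by simp)).1 (by rw [ENNReal.toReal_ofNat, ← inv_inj, h]; simp)
  obtain ⟨a1, a2, a3, a4, a5, a6⟩ := exponentRegion_subset hmem
  simp only [Matrix.cons_val_zero, Matrix.cons_val_one, Matrix.cons_val] at a1 a2 a3 a4 a5 a6
  -- A coordinate equal to `1/2` forces the other two to be `1`.
  have hα2 : 1 / 2 < p.toReal⁻¹ := by
    by_contra hcon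
    refine h₃ ?_
    rw [Prod.mk.injEq, Prod.mk.injEq]
    refine ⟨heq_two hpt ?_, heq_one ?_, heq_one ?_⟩ <;> linarith
  have hβ2 : 1 / 2 < q.toReal⁻¹ := by
    by_contra hcon
    refine h₂ ?_
    rw [Prod.mk.injEq, Prod.mk.injEq]
    refine ⟨heq_one ?_, heq_two hqt ?_, heq_one ?_⟩ <;> linarith
  have hκ2 : 1 / 2 < r.toReal⁻¹ := by
    by_contra hcon
    refine h₁ ?_
    rw [Prod.mk.injEq, Prod.mk.injEq]
    refine ⟨heq_one ?_, heq_one ?_, heq_two hrt ?_⟩ <;> linarith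
  obtain ⟨c, hc, hle⟩ := exists_eLpNorm_curveMultiplier_le hΓ ha hA
    (α := 1 - p.toReal⁻¹) (β := 1 - q.toReal⁻¹) (κ := 1 - r.toReal⁻¹) (by linarith) (by linarith)
    (by linarith) (by linarith) (by linarith) (by linarith) (by linarith) (by linarith)
    (by linarith)
  have hr' : (ENNReal.ofReal (1 - r.toReal⁻¹))⁻¹ = r' := by
    rw [ENNReal.ofReal_sub _ (by positivity), hinv hr, ENNReal.ofReal_one, ← hrr',
      ENNReal.add_sub_cancel_left (ENNReal.inv_ne_top.2 (one_pos.trans_le hr.1).ne'), inv_inv]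
  simp only [sub_sub_cancel, hinv hp, hinv hq, inv_inv, hr'] at hle
  refine isBoundedBilinear_of_eLpNorm_le hpt hqt
    (fun f g ↦ (continuous_curveMultiplier ha hA f g).aestronglyMeasurable) ?_ ?_ ?_ ?_ hc hle
  · intro f f' g
    funext x
    rw [Pi.add_apply, curveMultiplier, curveMultiplier, curveMultiplier,
      ← integral_add (integrable_curveMultiplier ha hA f g x)
        (integrable_curveMultiplier ha hA f' g x)]
    refine integral_congr_ae (.of_forall fun z ↦ ?_)
    simp only [fourierHat_add]
    ring
  · intro f g g'
    funext x
    rw [Pi.add_apply, curveMultiplier, curveMultiplier, curveMultiplier,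
      ← integral_add (integrable_curveMultiplier ha hA f g x)
        (integrable_curveMultiplier ha hA f g' x)]
    refine integral_congr_ae (.of_forall fun z ↦ ?_)
    simp only [fourierHat_add]
    ring
  · intro b f g
    funext x
    rw [Pi.smul_apply, curveMultiplier, curveMultiplier, smul_eq_mul, ← integral_const_mul]
    refine integral_congr_ae (.of_forall fun z ↦ ?_)
    simp only [fourierHat_smul]
    ring
  · intro b f g
    funext x
    rw [Pi.smul_apply, curveMultiplier, curveMultiplier, smul_eq_mul, ← integral_const_mul]
    refine integral_congr_ae (.of_forall fun z ↦ ?_)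
    simp only [fourierHat_smul]
    ring

end Operator

end BilinearRestriction


theorem mainTheorem6
    (Γ : Set BilinearRestriction.Plane) (hΓ : BilinearRestriction.IsSmoothCurvedCurve Γ)
    (p q r r' : ℝ≥0∞) [Fact (1 ≤ p)] [Fact (1 ≤ q)] [Fact (1 ≤ r')]
    (hp : p ∈ Icc 1 2) (hq : q ∈ Icc 1 2) (hr : r ∈ Icc 1 2) (hrr' : r⁻¹ + r'⁻¹ = 1)
    (hmem : ![p.toReal⁻¹, q.toReal⁻¹, r.toReal⁻¹] ∈ BilinearRestriction.exponentRegion)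
    (h₁ : (p, q, r) ≠ (1, 1, 2)) (h₂ : (p, q, r) ≠ (1, 2, 1)) (h₃ : (p, q, r) ≠ (2, 1, 1)) :
    BilinearRestriction.IsBoundedBilinear
        (BilinearRestriction.curveMultiplier Γ (fun _ => 1)) p q r' ∧
      BilinearRestriction.RestrictionExtension Γ p q r' := by
  refine ⟨BilinearRestriction.isBoundedBilinear_curveMultiplier hΓ continuous_const (A := 1)
    (fun _ ↦ by simp) hp hq hr hrr' hmem h₁ h₂ h₃, fun a ha hac ↦ ?_⟩
  obtain ⟨A, hA⟩ := hac.exists_bound_of_continuous ha.continuous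
  exact BilinearRestriction.isBoundedBilinear_curveMultiplier hΓ ha.continuous hA hp hq hr hrr'
    hmem h₁ h₂ h₃
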